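/- Let $P$ be a bounded pyramid in hyperbolic space $\mathbb{H}^3$, that is, the convex hull of a point $O\in\mathbb{H}^3$ (the apex) and a convex polygon with vertices in $\mathbb{H}^3$ (the base) lying in a plane that does not contain $O$; tetrahedra are included. A Coxeter polyhedron is a convex polyhedron in $\mathbb{H}^3$ (a finite intersection of closed half-spaces, with non-empty interior) all of whose dihedral angles are of the form $\pi/k$ with an integer $k\ge 2$. Suppose that $P$ admits a Coxeter decomposition, that is, $P$ is tiled face-to-face by finitely many Coxeter polyhedra with pairwise disjoint interiors such that any two tiles having a common two-dimensional face are symmetric to each other with respect to the plane of this face. Then every tile of the decomposition (a so-called fundamental polyhedron) is a tetrahedron, that is, the convex hull of four points of $\mathbb{H}^3$ that do not lie in one plane. -/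

import Mathlib

namespace Hyp3

/-- The ambient Minkowski space `ℝ^{3,1}`; the coordinate `x 0` is the time coordinate. -/
abbrev V := Fin 4 → ℝ

/-- The Minkowski form of signature `(3,1)`. -/
def mink (x y : V) : ℝ := -(x 0 * y 0) + x 1 * y 1 + x 2 * y 2 + x 3 * y 3

/-- The hyperbolic space `H^3`, in the hyperboloid model. As a subtype it carries the subspace
topology, which is the topology of the hyperbolic metric. -/
abbrev Space := {x : V // mink x x = -1 ∧ 0 < x 0}

/-- Unit space-like vectors. Each of them is a unit normal of a plane of `H^3`, and each plane
has exactly two of them, which are opposite to each other. -/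
abbrev Normal := {n : V // mink n n = 1}

/-- The hyperbolic plane with unit normal `n`. -/
def plane (n : Normal) : Set Space := {x | mink n x = 0}

/-- The closed half-space bounded by `plane n` for which `n` is the outer normal. -/
def halfSpace (n : Normal) : Set Space := {x | mink n x ≤ 0}

theorem reflect_mem (n : Normal) (x : Space) :
    mink (x.1 - (2 * mink n.1 x.1) • n.1) (x.1 - (2 * mink n.1 x.1) • n.1) = -1 ∧
      0 < (x.1 - (2 * mink n.1 x.1) • n.1) 0 := by
  obtain ⟨n, hn⟩ := n
  obtain ⟨x, hx, hx0⟩ := x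
  set b := mink n x with hb
  have h1 : mink (x - (2 * b) • n) (x - (2 * b) • n) = -1 := by
    have : mink (x - (2 * b) • n) (x - (2 * b) • n)
        = mink x x - 4 * b * mink n x + 4 * b ^ 2 * mink n n := by
      simp only [mink, Pi.sub_apply, Pi.smul_apply, smul_eq_mul]; ring
    rw [this, hn, hx, ← hb]; ring
  refine ⟨h1, ?_⟩
  have h2 : mink x (x - (2 * b) • n) = -1 - 2 * b ^ 2 := by
    have : mink x (x - (2 * b) • n) = mink x x - 2 * b * mink n x := by
      simp only [mink, Pi.sub_apply, Pi.smul_apply, smul_eq_mul]; ring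
    rw [this, hx, ← hb]; ring
  generalize x - (2 * b) • n = y at h1 h2
  change 0 < y 0
  by_contra hy
  push Not at hy
  simp only [mink] at h1 h2 hx
  -- the spatial parts satisfy the Cauchy-Schwarz inequality
  have cs : (x 1 * y 1 + x 2 * y 2 + x 3 * y 3) ^ 2
      ≤ (x 1 ^ 2 + x 2 ^ 2 + x 3 ^ 2) * (y 1 ^ 2 + y 2 ^ 2 + y 3 ^ 2) := by
    nlinarith [sq_nonneg (x 1 * y 2 - x 2 * y 1), sq_nonneg (x 1 * y 3 - x 3 * y 1),
      sq_nonneg (x 2 * y 3 - x 3 * y 2)]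
  have e1 : x 1 ^ 2 + x 2 ^ 2 + x 3 ^ 2 = x 0 ^ 2 - 1 := by linarith
  have e2 : y 1 ^ 2 + y 2 ^ 2 + y 3 ^ 2 = y 0 ^ 2 - 1 := by linarith
  rw [e1, e2] at cs
  have hp : 0 ≤ x 0 * -y 0 := mul_nonneg hx0.le (by linarith)
  have e3 : x 1 * y 1 + x 2 * y 2 + x 3 * y 3 = -1 - 2 * b ^ 2 - x 0 * -y 0 := by linarith
  rw [e3] at cs
  have hx1 : 1 ≤ x 0 ^ 2 := by nlinarith [sq_nonneg (x 1), sq_nonneg (x 2), sq_nonneg (x 3)]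
  have hy1 : 1 ≤ y 0 ^ 2 := by nlinarith [sq_nonneg (y 1), sq_nonneg (y 2), sq_nonneg (y 3)]
  nlinarith [sq_nonneg b, mul_nonneg hp (sq_nonneg b), sq_nonneg (b ^ 2)]

/-- The reflection of `H^3` in the plane with unit normal `n`. -/
def reflection (n : Normal) (x : Space) : Space :=
  ⟨x.1 - (2 * mink n.1 x.1) • n.1, reflect_mem n x⟩

/-- The dimension of the linear span of a subset of `H^3`. It is one more than the dimension of
the smallest totally geodesic subspace that contains the set: the rank of a convex set is `3` if
the set is two-dimensional and `2` if it is one-dimensional. -/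
noncomputable def spanRank (X : Set Space) : ℕ :=
  Module.finrank ℝ (Submodule.span ℝ ((fun x : Space => (x : V)) '' X))

/-- A convex polyhedron: an intersection of finitely many closed half-spaces that has interior
points. -/
def IsPolyhedron (F : Set Space) : Prop :=
  (∃ N : Set Normal, N.Finite ∧ F = ⋂ n ∈ N, halfSpace n) ∧ (interior F).Nonempty

/-- `n` is the outer unit normal of a (two-dimensional) face of `F`; the face is
`F ∩ plane n`. -/
def IsFaceNormal (F : Set Space) (n : Normal) : Prop :=
  F ⊆ halfSpace n ∧ spanRank (F ∩ plane n) = 3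

/-- `f` is a (two-dimensional) face of `F`. -/
def IsFace (F f : Set Space) : Prop :=
  ∃ n : Normal, IsFaceNormal F n ∧ f = F ∩ plane n

/-- The angle between the faces with outer unit normals `n` and `m`, measured inside the
polyhedron. -/
noncomputable def dihedralAngle (n m : Normal) : ℝ := Real.arccos (-mink n m)

/-- A Coxeter polyhedron: whenever two faces have a common edge, the dihedral angle at this edge
is `π / k` for an integer `k ≥ 2`. -/
def IsCoxeterPolyhedron (F : Set Space) : Prop :=
  IsPolyhedron F ∧
    ∀ n m : Normal, IsFaceNormal F n → IsFaceNormal F m →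
      spanRank (F ∩ plane n ∩ plane m) = 2 →
        ∃ k : ℕ, 2 ≤ k ∧ dihedralAngle n m = Real.pi / k

/-- `T` is the set of tiles of a Coxeter decomposition of `P`: a tiling of `P`, face to face, by
finitely many Coxeter polyhedra such that any two tiles with a common face are symmetric with
respect to the plane of this face. -/
structure IsCoxeterDecomposition (P : Set Space) (T : Set (Set Space)) : Prop where
  finite : T.Finite
  coxeter : ∀ F ∈ T, IsCoxeterPolyhedron F
  cover : ⋃₀ T = P
  disjoint : ∀ F ∈ T, ∀ G ∈ T, F ≠ G → Disjoint (interior F) (interior G)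
  faceToFace : ∀ F ∈ T, ∀ G ∈ T, F ≠ G → spanRank (F ∩ G) = 3 →
    IsFace F (F ∩ G) ∧ IsFace G (F ∩ G)
  symmetric : ∀ F ∈ T, ∀ G ∈ T, F ≠ G → ∀ n : Normal, IsFaceNormal F n →
    IsFace G (F ∩ plane n) → G = reflection n '' F

/-- The convex hull in `H^3`: the central projection to the hyperboloid of the convex hull in
the ambient vector space. -/
def hull (A : Set Space) : Set Space :=
  {x | ∃ c : ℝ, 0 < c ∧ c • (x : V) ∈ convexHull ℝ ((fun x : Space => (x : V)) '' A)}

/-- A bounded pyramid: the convex hull of an apex `O` and of a polygon, which is itself the hull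
of finitely many points of `H^3` that lie in a plane not containing `O` and not on one line.
Tetrahedra are the pyramids over triangles. -/
def IsBoundedPyramid (P : Set Space) : Prop :=
  ∃ (O : Space) (A : Set Space) (b : Normal),
    A.Finite ∧ A ⊆ plane b ∧ spanRank A = 3 ∧ O ∉ plane b ∧ P = hull (insert O A)

/-- A (bounded, nondegenerate) tetrahedron: the convex hull of four points of `H^3` that do not
lie in one plane. -/
def IsTetrahedron (F : Set Space) : Prop :=
  ∃ v : Fin 4 → Space, LinearIndependent ℝ (fun i => (v i : V)) ∧ F = hull (Set.range v)

end Hyp3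

open Filter Topology
namespace Hyp3

/-! ### The Minkowski form -/

/-! Pass to the cone `K` over the pyramid in Minkowski space. A tile becomes the finite set of outer
unit normals of its faces, and a wall is the plane of any face of any tile. Four facts carry the
proof.

Walls do not cut tiles (`mink_ne_zero_of_interior`, `tileCone_side`). All tiles around an edge are
mirror images of one another with the same angle `π / k`, so they close up to a half-turn and a wall
continues straight across the edge; since the pyramid is convex, it continues through the whole
body. For the same reason, where a wall bounds a part of the body, reflection in it permutes the
walls that meet it there (`refl_mem_walls`).

The tiles are acute-angled: any two different outer normals have a non-positive product, even if the
faces are not adjacent (`mink_nonpos`). Hence the normals of a tile through the apex `O` are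
linearly independent. The pyramid contains no line segment with midpoint `O`, so there are exactly
three of them. Together with the base they bound a simplex of walls inside the body
(`exists_simplex_of_apex`).

A simplex of walls in the body that is minimal for inclusion is a tile (`exists_isSimplexTile`). By
minimality a wall that separates its vertices leaves two on each side. Among such walls take `m`
with the smallest sum of absolute values at the vertices. If reflecting `m` in a facet of the
simplex decreased this sum, `m` would not be minimal; if it flipped the sign at a vertex, the image
would cut off a single vertex. This forces all terms in the expansion of `mink m m` along the facet
normals to be non-positive, although `mink m m = 1`.

Finally, every tile is reached from this one by reflections in faces (`forall_of_refl`), so all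
tiles are tetrahedra. -/

theorem mink_comm (x y : V) : mink x y = mink y x := by simp only [mink]; ring

@[simp] theorem mink_add_left (x y z : V) : mink (x + y) z = mink x z + mink y z := by
  simp only [mink, Pi.add_apply]; ring

@[simp] theorem mink_add_right (x y z : V) : mink x (y + z) = mink x y + mink x z := by
  simp only [mink, Pi.add_apply]; ring

@[simp] theorem mink_sub_left (x y z : V) : mink (x - y) z = mink x z - mink y z := by
  simp only [mink, Pi.sub_apply]; ring

@[simp] theorem mink_sub_right (x y z : V) : mink x (y - z) = mink x y - mink x z := by
  simp only [mink, Pi.sub_apply]; ring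

@[simp] theorem mink_neg_left (x y : V) : mink (-x) y = -mink x y := by
  simp only [mink, Pi.neg_apply]; ring

@[simp] theorem mink_neg_right (x y : V) : mink x (-y) = -mink x y := by
  simp only [mink, Pi.neg_apply]; ring

@[simp] theorem mink_smul_left (c : ℝ) (x y : V) : mink (c • x) y = c * mink x y := by
  simp only [mink, Pi.smul_apply, smul_eq_mul]; ring

@[simp] theorem mink_smul_right (c : ℝ) (x y : V) : mink x (c • y) = c * mink x y := by
  simp only [mink, Pi.smul_apply, smul_eq_mul]; ring

@[simp] theorem mink_zero_left (x : V) : mink 0 x = 0 := by simp [mink]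

@[simp] theorem mink_zero_right (x : V) : mink x 0 = 0 := by simp [mink]

@[fun_prop] theorem continuous_mink {X : Type*} [TopologicalSpace X] {f g : X → V}
    (hf : Continuous f) (hg : Continuous g) : Continuous fun x => mink (f x) (g x) := by
  unfold mink; fun_prop

/-- The Minkowski form as a bilinear form. -/
noncomputable def minkForm : LinearMap.BilinForm ℝ V :=
  LinearMap.mk₂ ℝ mink mink_add_left mink_smul_left mink_add_right mink_smul_right

@[simp] theorem minkForm_apply (x y : V) : minkForm x y = mink x y := rfl

theorem mink_sum_left {ι : Type*} (s : Finset ι) (f : ι → V) (x : V) :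
    mink (∑ i ∈ s, f i) x = ∑ i ∈ s, mink (f i) x := by
  rw [← minkForm_apply, map_sum, LinearMap.sum_apply]; rfl

theorem mink_sum_right {ι : Type*} (s : Finset ι) (f : ι → V) (x : V) :
    mink x (∑ i ∈ s, f i) = ∑ i ∈ s, mink x (f i) := by
  rw [← minkForm_apply, map_sum]; rfl

theorem eq_zero_of_mink_eq_zero {x : V} (h : ∀ y, mink x y = 0) : x = 0 := by
  -- Pairing `x` with its time reversal gives the Euclidean square norm.
  have h' : mink x ![-x 0, x 1, x 2, x 3] = 0 := h _
  simp only [mink, Matrix.cons_val] at h'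
  have key (i : Fin 4) : x i * x i = 0 := by
    have := mul_self_nonneg (x 0)
    have := mul_self_nonneg (x 1)
    have := mul_self_nonneg (x 2)
    have := mul_self_nonneg (x 3)
    fin_cases i <;> simp only [Fin.zero_eta, Fin.mk_one, Fin.reduceFinMk] <;> linarith
  ext i
  exact mul_self_eq_zero.1 (key i)

theorem minkForm_isRefl : minkForm.IsRefl := fun x y h => by
  rw [minkForm_apply, mink_comm]; exact h

theorem minkForm_nondegenerate : minkForm.Nondegenerate :=
  ⟨fun _ h => eq_zero_of_mink_eq_zero h,
    fun x h => eq_zero_of_mink_eq_zero fun y => by rw [mink_comm]; exact h y⟩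

/-- The vectors orthogonal to all elements of a set. -/
noncomputable def perp (s : Set V) : Submodule ℝ V := minkForm.orthogonal (Submodule.span ℝ s)

theorem mem_perp {s : Set V} {v : V} : v ∈ perp s ↔ ∀ n ∈ s, mink n v = 0 := by
  refine ⟨fun h n hn => h n (Submodule.subset_span hn), fun h n hn => ?_⟩
  change mink n v = 0
  induction hn using Submodule.span_induction with
  | mem x hx => exact h x hx
  | zero => simp
  | add x y _ _ hx hy => simp [hx, hy]
  | smul c x _ hx => simp [hx]

theorem finrank_perp (s : Set V) :
    Module.finrank ℝ (perp s) = 4 - Module.finrank ℝ (Submodule.span ℝ s) := by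
  rw [perp, LinearMap.BilinForm.finrank_orthogonal minkForm_nondegenerate]; simp

theorem ne_zero_of_unit {n : V} (hn : mink n n = 1) : n ≠ 0 := by
  rintro rfl; simp at hn

theorem finrank_perp_singleton {n : V} (hn : n ≠ 0) :
    Module.finrank ℝ (perp {n}) = 3 := by
  rw [finrank_perp, finrank_span_singleton hn]

/-- A vector orthogonal to `n^⊥` is a multiple of `n`. -/
theorem exists_smul_of_perp_le {n m : V} (h : ∀ v, mink n v = 0 → mink m v = 0) :
    ∃ c : ℝ, m = c • n := by
  have hm : m ∈ minkForm.orthogonal (perp {n}) := fun v hv => by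
    change mink v m = 0
    rw [mink_comm]; exact h v (mem_perp.1 hv n rfl)
  rw [perp, LinearMap.BilinForm.orthogonal_orthogonal minkForm_nondegenerate minkForm_isRefl] at hm
  obtain ⟨c, hc⟩ := Submodule.mem_span_singleton.1 hm
  exact ⟨c, hc.symm⟩

theorem eq_or_eq_neg_of_smul {n m : V} (hn : mink n n = 1) (hm : mink m m = 1) {c : ℝ}
    (h : m = c • n) : m = n ∨ m = -n := by
  subst h
  simp [hn] at hm
  rcases mul_self_eq_one_iff.1 hm with rfl | rfl <;> simp

/-! ### The future cone -/

/-- The open cone over the hyperboloid. -/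
def future : Set V := {v | mink v v < 0 ∧ 0 < v 0}

theorem isOpen_future : IsOpen future :=
  IsOpen.inter (isOpen_lt (f := fun v : V => mink v v) (by fun_prop) continuous_const)
    (isOpen_lt (f := fun _ : V => (0 : ℝ)) (g := fun v : V => v 0) continuous_const (by fun_prop))

theorem cauchy_schwarz_spatial (x y : V) : (x 1 * y 1 + x 2 * y 2 + x 3 * y 3) ^ 2
      ≤ (x 1 ^ 2 + x 2 ^ 2 + x 3 ^ 2) * (y 1 ^ 2 + y 2 ^ 2 + y 3 ^ 2) := by
  nlinarith [sq_nonneg (x 1 * y 2 - x 2 * y 1), sq_nonneg (x 1 * y 3 - x 3 * y 1),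
      sq_nonneg (x 2 * y 3 - x 3 * y 2)]

theorem mink_neg_of_future {x y : V} (hx : x ∈ future) (hy : y ∈ future) : mink x y < 0 := by
  obtain ⟨hx, hx0⟩ := hx
  obtain ⟨hy, hy0⟩ := hy
  simp only [mink] at *
  have cs := cauchy_schwarz_spatial x y
  have h : (x 1 * y 1 + x 2 * y 2 + x 3 * y 3) ^ 2 < (x 0 * y 0) ^ 2 := by
    refine cs.trans_lt ?_
    rw [mul_pow]
    apply mul_lt_mul'' <;> nlinarith [sq_nonneg (x 1), sq_nonneg (x 2), sq_nonneg (x 3),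
      sq_nonneg (y 1), sq_nonneg (y 2), sq_nonneg (y 3)]
  have := abs_lt_of_sq_lt_sq h (by positivity)
  linarith [(abs_lt.1 this).2]

/-- The form is positive definite on the orthogonal complement of a time-like vector. -/
theorem mink_self_pos {x y : V} (hx : x ∈ future) (h : mink x y = 0) (hy : y ≠ 0) :
    0 < mink y y := by
  by_contra hc
  push Not at hc
  obtain ⟨hx, hx0⟩ := hx
  have cs := cauchy_schwarz_spatial x y
  simp only [mink] at *
  have e : x 1 * y 1 + x 2 * y 2 + x 3 * y 3 = x 0 * y 0 := by linarith
  rw [e] at cs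
  set a := y 1 ^ 2 + y 2 ^ 2 + y 3 ^ 2 with ha
  set b := x 1 ^ 2 + x 2 ^ 2 + x 3 ^ 2 with hb
  have h1 : a ≤ y 0 ^ 2 := by nlinarith
  have h2 : b < x 0 ^ 2 := by nlinarith
  have hb0 : 0 ≤ b := by positivity
  have ha0 : 0 ≤ a := by positivity
  -- If `y 0 ≠ 0`, the strict inequality `b < x 0 ^ 2` makes `b * a` smaller than `(x 0 * y 0) ^ 2`,
  -- against Cauchy-Schwarz.
  have h3 : y 0 ^ 2 = 0 := by
    by_contra h0
    have : 0 < y 0 ^ 2 := by positivity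
    nlinarith
  have h4 : a = 0 := by linarith
  apply hy
  ext i
  fin_cases i
  · exact pow_eq_zero_iff (two_ne_zero) |>.1 h3
  all_goals
    simp only [Fin.mk_one, Fin.reduceFinMk, Pi.zero_apply]
    refine pow_eq_zero_iff (two_ne_zero) |>.1 ?_
    linarith [sq_nonneg (y 1), sq_nonneg (y 2), sq_nonneg (y 3)]

theorem future_of_timelike {x y : V} (hx : x ∈ future) (hy : mink y y < 0) (h : mink x y < 0) :
    y ∈ future := by
  refine ⟨hy, ?_⟩
  by_contra h0
  push Not at h0
  rcases h0.lt_or_eq with h0 | h0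
  · have := mink_neg_of_future hx (y := -y) ⟨by simpa using hy, by simpa using h0⟩
    simp at this; linarith
  · simp only [mink, h0] at hy
    nlinarith [sq_nonneg (y 1), sq_nonneg (y 2), sq_nonneg (y 3)]

theorem future_add {x y : V} (hx : x ∈ future) (hy : y ∈ future) : x + y ∈ future := by
  have h := mink_neg_of_future hx hy
  refine ⟨?_, add_pos hx.2 hy.2⟩
  have h1 := hx.1
  have h2 := hy.1
  simp [mink_comm y x]; linarith

theorem future_smul {x : V} {c : ℝ} (hc : 0 < c) (hx : x ∈ future) : c • x ∈ future := by
  refine ⟨?_, mul_pos hc hx.2⟩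
  have h1 := hx.1
  simp only [mink_smul_left, mink_smul_right]
  nlinarith [mul_pos hc hc]

theorem future_add_smul {x y : V} {c : ℝ} (hc : 0 ≤ c) (hx : x ∈ future) (hy : y ∈ future) :
    x + c • y ∈ future := by
  rcases hc.eq_or_lt with rfl | hc
  · simpa using hx
  · exact future_add hx (future_smul hc hy)

theorem ne_zero_of_future {x : V} (hx : x ∈ future) : x ≠ 0 := by
  rintro rfl; exact lt_irrefl _ hx.2

/-! ### Reflections -/

/-- The linear reflection with unit normal `n`. -/
def refl (n v : V) : V := v - (2 * mink n v) • n

theorem refl_self {n : V} (hn : mink n n = 1) : refl n n = -n := by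
  simp only [refl, hn]; module

theorem mink_refl_refl {n : V} (hn : mink n n = 1) (x y : V) :
    mink (refl n x) (refl n y) = mink x y := by
  simp [refl, hn, mink_comm x n]; ring

theorem refl_refl {n : V} (hn : mink n n = 1) (x : V) : refl n (refl n x) = x := by
  simp only [refl, mink_sub_right, mink_smul_right, hn]; module

theorem mink_refl_left {n : V} (x y : V) : mink (refl n x) y = mink x (refl n y) := by
  simp [refl, mink_comm x n]; ring

theorem refl_of_mink_eq_zero {n x : V} (h : mink n x = 0) : refl n x = x := by
  simp [refl, h]

theorem refl_neg_left (n x : V) : refl (-n) x = refl n x := by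
  simp [refl]

theorem refl_neg_right (n x : V) : refl n (-x) = -refl n x := by
  simp only [refl, mink_neg_right]; module

theorem refl_add (n x y : V) : refl n (x + y) = refl n x + refl n y := by
  simp only [refl, mink_add_right]; module

theorem refl_smul (n : V) (c : ℝ) (x : V) : refl n (c • x) = c • refl n x := by
  simp only [refl, mink_smul_right]; module

theorem refl_future {n x : V} (hn : mink n n = 1) (hx : x ∈ future) : refl n x ∈ future := by
  apply future_of_timelike hx
  · rw [mink_refl_refl hn]; exact hx.1
  · have h1 := hx.1
    simp only [refl, mink_sub_right, mink_smul_right, mink_comm x n]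
    nlinarith [mul_self_nonneg (mink n x)]

/-! ### Convex sets and finite unions of subspaces -/

/-- Pigeonhole on a segment: if `x` avoids one subspace and `y` avoids all the others, two of the
infinitely many points between them share a subspace, which then contains both `x` and `y`. This is
the source of all general-position arguments below. -/
theorem exists_subset_submodule_of_convex {E ι : Type*} [AddCommGroup E] [Module ℝ E] {C : Set E}
    (hC : Convex ℝ C) (s : Finset ι) (S : ι → Submodule ℝ E) (hne : C.Nonempty)
    (h : C ⊆ ⋃ i ∈ s, (S i : Set E)) : ∃ i ∈ s, C ⊆ S i := by
  classical
  induction s using Finset.induction_on with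
  | empty => obtain ⟨x, hx⟩ := hne; simpa using h hx
  | insert i s hi ih =>
    by_cases h1 : C ⊆ ⋃ j ∈ s, (S j : Set E)
    · obtain ⟨j, hj, hj'⟩ := ih h1
      exact ⟨j, Finset.mem_insert_of_mem hj, hj'⟩
    · by_contra hcon
      push Not at hcon
      obtain ⟨x, hx, hxi⟩ := Set.not_subset.1 (hcon i (Finset.mem_insert_self _ _))
      obtain ⟨y, hy, hys⟩ := Set.not_subset.1 h1
      simp only [Set.mem_iUnion, SetLike.mem_coe, not_exists] at hys
      have key : ∀ t : Set.Ioo (0 : ℝ) 1, ∃ j : ↥(insert i s),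
          (1 - t.1) • x + t.1 • y ∈ S j := by
        intro t
        have := h (hC hx hy (a := 1 - t.1) (b := t.1) (by linarith [t.2.2]) t.2.1.le (by ring))
        simp only [Set.mem_iUnion] at this
        obtain ⟨j, hj, hj'⟩ := this
        exact ⟨⟨j, hj⟩, hj'⟩
      choose f hf using key
      have : Infinite (Set.Ioo (0 : ℝ) 1) := (Set.Ioo_infinite one_pos).to_subtype
      obtain ⟨t, t', hne, htt⟩ := Finite.exists_ne_map_eq_of_infinite f
      have h2 := hf t'
      rw [← htt] at h2
      have h1 := hf t
      have hne' : t.1 - t'.1 ≠ 0 := sub_ne_zero.2 fun h => hne (Subtype.ext h)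
      have hx' : x ∈ S (f t) := by
        have : (t.1 - t'.1) • x ∈ S (f t) := by
          have := (S (f t)).sub_mem ((S (f t)).smul_mem t.1 h2) ((S (f t)).smul_mem t'.1 h1)
          convert this using 1; module
        exact ((S (f t)).smul_mem_iff hne').1 this
      have hy' : y ∈ S (f t) := by
        have : (t.1 - t'.1) • y ∈ S (f t) := by
          have := (S (f t)).sub_mem ((S (f t)).smul_mem (1 - t'.1) h1)
            ((S (f t)).smul_mem (1 - t.1) h2)
          convert this using 1; module
        exact ((S (f t)).smul_mem_iff hne').1 this
      rcases Finset.mem_insert.1 (f t).2 with hj | hj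
      · rw [hj] at hx'; exact hxi hx'
      · exact hys _ hj hy'

/-- A convex set not contained in any of finitely many subspaces has a point off all of them. -/
theorem exists_mem_forall_notMem_submodule {E ι : Type*} [AddCommGroup E] [Module ℝ E] {C : Set E}
    (hC : Convex ℝ C) {s : Set ι} (hs : s.Finite) (S : ι → Submodule ℝ E) (hne : C.Nonempty)
    (h : ∀ i ∈ s, ∃ x ∈ C, x ∉ S i) : ∃ x ∈ C, ∀ i ∈ s, x ∉ S i := by
  by_contra hcon
  push Not at hcon
  obtain ⟨i, hi, hi'⟩ := exists_subset_submodule_of_convex hC hs.toFinset S hne (fun x hx => by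
    obtain ⟨i, hi, hxi⟩ := hcon x hx
    simp only [Set.mem_iUnion]
    exact ⟨i, by simpa using hi, hxi⟩)
  obtain ⟨x, hx, hx'⟩ := h i (by simpa using hi)
  exact hx' (hi' hx)

/-! ### Cones of tiles -/

/-- The time-like cone cut out by a set of outer normals. -/
def tileCone (N : Set V) : Set V := {v | v ∈ future ∧ ∀ n ∈ N, mink n v ≤ 0}

theorem continuous_line (x y : V) : Continuous fun ε : ℝ => x + ε • y := by fun_prop

theorem tendsto_line (x y : V) : Tendsto (fun ε : ℝ => x + ε • y) (𝓝[>] 0) (𝓝 x) := by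
  have := (continuous_line x y).tendsto 0
  simp only [zero_smul, add_zero] at this
  exact this.mono_left nhdsWithin_le_nhds

theorem eventually_future {x : V} (hx : x ∈ future) (y : V) :
    ∀ᶠ ε : ℝ in 𝓝[>] 0, x + ε • y ∈ future :=
  tendsto_line x y (isOpen_future.mem_nhds hx)

theorem eventually_pos_right : ∀ᶠ ε : ℝ in 𝓝[>] (0 : ℝ), 0 < ε := self_mem_nhdsWithin

theorem eventually_mink_neg {n x : V} (h : mink n x < 0) (y : V) :
    ∀ᶠ ε : ℝ in 𝓝[>] 0, mink n (x + ε • y) < 0 :=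
  tendsto_line x y ((isOpen_lt (f := fun v => mink n v) (by fun_prop) continuous_const).mem_nhds h)

/-- Strict inequalities at `x` survive small moves, so only the normals active at `x` restrict the
direction `y`. -/
theorem eventually_mem_tileCone {N : Set V} (hN : N.Finite) {x y : V} (hx : x ∈ tileCone N)
    (hy : ∀ l ∈ N, mink l x = 0 → mink l y ≤ 0) :
    ∀ᶠ ε : ℝ in 𝓝[>] 0, x + ε • y ∈ tileCone N := by
  refine (eventually_future hx.1 y).and ((eventually_all_finite hN).2 fun l hl => ?_)
  rcases (hx.2 l hl).lt_or_eq with h | h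
  · filter_upwards [eventually_mink_neg h y] with ε hε using hε.le
  · filter_upwards [eventually_pos_right] with ε hε
    rw [mink_add_right, mink_smul_right, h, zero_add]
    exact mul_nonpos_of_nonneg_of_nonpos hε.le (hy l hl h)

theorem eventually_interior_tileCone {N : Set V} (hN : N.Finite) {x y : V} (hx : x ∈ tileCone N)
    (hy : ∀ l ∈ N, mink l x = 0 → mink l y < 0) :
    ∀ᶠ ε : ℝ in 𝓝[>] 0, x + ε • y ∈ future ∧ ∀ l ∈ N, mink l (x + ε • y) < 0 := by
  refine (eventually_future hx.1 y).and ((eventually_all_finite hN).2 fun l hl => ?_)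
  rcases (hx.2 l hl).lt_or_eq with h | h
  · exact eventually_mink_neg h y
  · filter_upwards [eventually_pos_right] with ε hε
    rw [mink_add_right, mink_smul_right, h, zero_add]
    exact mul_neg_of_pos_of_neg hε (hy l hl h)

theorem tileCone_smul {N : Set V} {x : V} (hx : x ∈ tileCone N) {c : ℝ} (hc : 0 < c) :
    c • x ∈ tileCone N :=
  ⟨future_smul hc hx.1, fun n hn => by
    rw [mink_smul_right]; exact mul_nonpos_of_nonneg_of_nonpos hc.le (hx.2 n hn)⟩

theorem isOpen_interior_tileCone {N : Set V} (hN : N.Finite) :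
    IsOpen {v | v ∈ future ∧ ∀ n ∈ N, mink n v < 0} := by
  have : {v : V | ∀ n ∈ N, mink n v < 0} = ⋂ n ∈ N, {v | mink n v < 0} := by
    ext; simp
  refine isOpen_future.inter ?_
  change IsOpen {v : V | ∀ n ∈ N, mink n v < 0}
  rw [this]
  exact hN.isOpen_biInter fun n _ => isOpen_lt (by fun_prop) continuous_const

theorem exists_notMem_of_finrank_lt {S : Submodule ℝ V} {n : V} (hn : n ≠ 0)
    (h : Module.finrank ℝ S < 3) : ∃ d, mink n d = 0 ∧ d ∉ S := by
  by_contra hcon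
  push Not at hcon
  have : perp {n} ≤ S := fun d hd => hcon d (mem_perp.1 hd n rfl)
  have := Submodule.finrank_mono this
  rw [finrank_perp_singleton hn] at this
  omega

/-- A generic choice of a starting point in an open part of a plane, such that the line towards
`g` meets the planes with normals in `W` only at points where these planes form a pencil. -/
theorem exists_generic {n g y : V} {M W : Set V} (hM : M.Finite) (hW : W.Finite) (hn : n ≠ 0)
    (hg : mink n g = 0) (hy : y ∈ future) (hny : mink n y = 0) (hyM : ∀ m ∈ M, mink m y < 0) :
    ∃ f ∈ future, mink n f = 0 ∧ (∀ m ∈ M, mink m f < 0) ∧ ∀ m ∈ W, ∀ m' ∈ W, ∀ t : ℝ,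
      mink m (f + t • g) = 0 → mink m' (f + t • g) = 0 → ¬LinearIndependent ℝ ![n, m, m'] := by
  let C : Set V := {v | (v ∈ future ∧ ∀ m ∈ M, mink m v < 0) ∧ mink n v = 0}
  have hC : Convex ℝ C := by
    rw [convex_iff_forall_pos]
    rintro x ⟨⟨hx1, hx2⟩, hx3⟩ z ⟨⟨hz1, hz2⟩, hz3⟩ a b ha hb -
    refine ⟨⟨future_add (future_smul ha hx1) (future_smul hb hz1), fun m hm => ?_⟩, ?_⟩
    · rw [mink_add_right, mink_smul_right, mink_smul_right]
      nlinarith [mul_neg_of_pos_of_neg ha (hx2 m hm), mul_neg_of_pos_of_neg hb (hz2 m hm)]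
    · simp [hx3, hz3]
  let I : Set (V × V) := {i | (i.1 ∈ W ∧ i.2 ∈ W) ∧ LinearIndependent ℝ ![n, i.1, i.2]}
  -- If the line from `f` in direction `g` meets the one-dimensional space `perp {n, m, m'}`, then
  -- `f` lies in this sum. Its dimension is at most `2`, so the three-dimensional plane of `n` has
  -- room outside all of these finitely many subspaces.
  let S : V × V → Submodule ℝ V := fun i => Submodule.span ℝ {g} ⊔ perp {n, i.1, i.2}
  have hS : ∀ i ∈ I, Module.finrank ℝ (S i) < 3 := by
    intro i hi
    have h1 := Submodule.finrank_add_le_finrank_add_finrank (Submodule.span ℝ {g})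
      (perp {n, i.1, i.2})
    have h2 : Module.finrank ℝ (Submodule.span ℝ {g}) ≤ 1 :=
      (finrank_span_le_card ({g} : Set V)).trans (by simp)
    have h3 : Module.finrank ℝ (Submodule.span ℝ {n, i.1, i.2}) = 3 := by
      have := finrank_span_eq_card hi.2
      have hr : Set.range ![n, i.1, i.2] = {n, i.1, i.2} := by
        simp [Matrix.range_cons, Set.insert_def, Set.union_def, Set.mem_singleton_iff]
      rwa [hr] at this
    rw [finrank_perp, h3] at h1
    change Module.finrank ℝ ↥(Submodule.span ℝ {g} ⊔ perp {n, i.1, i.2}) < 3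
    omega
  obtain ⟨f, hf, hfS⟩ := exists_mem_forall_notMem_submodule hC (s := I)
    ((hW.prod hW).subset fun i hi => hi.1) S ⟨y, ⟨hy, hyM⟩, hny⟩ (fun i hi => by
      by_cases hyS : y ∈ S i
      · obtain ⟨d, hd, hdS⟩ := exists_notMem_of_finrank_lt hn (hS i hi)
        have hev : ∀ᶠ ε : ℝ in 𝓝[>] 0, y + ε • d ∈ {v | v ∈ future ∧ ∀ n ∈ M, mink n v < 0} :=
          tendsto_line y d ((isOpen_interior_tileCone hM).mem_nhds ⟨hy, hyM⟩)
        obtain ⟨ε, hε, hε0⟩ := (hev.and eventually_pos_right).exists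
        refine ⟨y + ε • d, ⟨hε, by simp [hny, hd]⟩, fun h => hdS ?_⟩
        exact ((S i).smul_mem_iff hε0.ne').1 (((S i).add_mem_iff_right hyS).1 h)
      · exact ⟨y, ⟨⟨hy, hyM⟩, hny⟩, hyS⟩)
  refine ⟨f, hf.1.1, hf.2, hf.1.2, fun m hm m' hm' t h1 h2 hli => ?_⟩
  apply hfS (m, m') ⟨⟨hm, hm'⟩, hli⟩
  have hz : f + t • g ∈ perp {n, m, m'} := by
    rw [mem_perp]
    rintro k (rfl | rfl | rfl)
    · simp [hf.2, hg]
    · exact h1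
    · exact h2
  have : f = (-t) • g + (f + t • g) := by module
  rw [this]
  exact Submodule.add_mem_sup (Submodule.smul_mem _ _ (Submodule.mem_span_singleton_self g)) hz

/-! ### Systems of tiles -/

/-- The linear-algebraic content of a Coxeter decomposition: every tile is given by the set of the
outer unit normals of its faces, and `K` is the cone over the decomposed body. -/
structure IsTileSystem (K : Set V) (𝒯 : Set (Set V)) : Prop where
  finite : 𝒯.Finite
  finite_normals : ∀ N ∈ 𝒯, N.Finite
  unit : ∀ N ∈ 𝒯, ∀ n ∈ N, mink n n = 1
  inner : ∀ N ∈ 𝒯, ∃ c ∈ future, ∀ n ∈ N, mink n c < 0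
  facet : ∀ N ∈ 𝒯, ∀ n ∈ N, ∃ f ∈ future, mink n f = 0 ∧ ∀ m ∈ N, m ≠ n → mink m f < 0
  -- The point `x` lies on the faces `n` and `m` and on no other face, so it is an inner point of an
  -- edge.
  angle : ∀ N ∈ 𝒯, ∀ n ∈ N, ∀ m ∈ N, n ≠ m → ∀ x ∈ future, mink n x = 0 → mink m x = 0 →
    (∀ l ∈ N, l ≠ n → l ≠ m → mink l x < 0) → ∃ k : ℕ, 2 ≤ k ∧ mink n m = -Real.cos (Real.pi / k)
  disjoint : ∀ N ∈ 𝒯, ∀ M ∈ 𝒯, ∀ x ∈ future, (∀ n ∈ N, mink n x < 0) → (∀ n ∈ M, mink n x < 0) →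
    N = M
  cover : ∀ v ∈ future, (v ∈ K ↔ ∃ N ∈ 𝒯, v ∈ tileCone N)
  add_mem : ∀ x ∈ K, ∀ y ∈ K, x + y ∈ K
  neighbor : ∀ N ∈ 𝒯, ∀ n ∈ N, ∀ x ∈ tileCone N, mink n x = 0 → K ∈ 𝓝 x → refl n '' N ∈ 𝒯

/-- The unit normals of all planes that contain a face of a tile. -/
def walls (𝒯 : Set (Set V)) : Set V := {m | ∃ N ∈ 𝒯, m ∈ N ∨ -m ∈ N}

theorem neg_mem_walls {𝒯 : Set (Set V)} {m : V} (h : m ∈ walls 𝒯) : -m ∈ walls 𝒯 := by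
  obtain ⟨N, hN, h⟩ := h
  exact ⟨N, hN, by rw [neg_neg]; exact h.symm⟩

theorem mem_walls {𝒯 : Set (Set V)} {m : V} {N : Set V} (hN : N ∈ 𝒯) (h : m ∈ N) : m ∈ walls 𝒯 :=
  ⟨N, hN, Or.inl h⟩

namespace IsTileSystem

variable {K : Set V} {𝒯 : Set (Set V)} (h : IsTileSystem K 𝒯)
include h

theorem finite_walls : (walls 𝒯).Finite := by
  have h1 : (⋃ N ∈ 𝒯, N).Finite := h.finite.biUnion fun N hN => h.finite_normals N hN
  refine (h1.union (h1.image Neg.neg)).subset ?_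
  rintro m ⟨N, hN, hm | hm⟩
  · exact Or.inl (Set.mem_biUnion hN hm)
  · exact Or.inr ⟨-m, Set.mem_biUnion hN hm, neg_neg m⟩

theorem unit_of_wall {m : V} (hm : m ∈ walls 𝒯) : mink m m = 1 := by
  obtain ⟨N, hN, hm | hm⟩ := hm
  · exact h.unit N hN m hm
  · simpa using h.unit N hN _ hm

theorem neg_notMem {N : Set V} (hN : N ∈ 𝒯) {n : V} (hn : n ∈ N) : -n ∉ N := fun hn' => by
  obtain ⟨c, -, hc⟩ := h.inner N hN
  have h1 := hc n hn
  have h2 := hc _ hn'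
  rw [mink_neg_left] at h2
  linarith

/-- Three different faces of a tile do not belong to a pencil of planes. -/
theorem linearIndependent_of_ne {N : Set V} (hN : N ∈ 𝒯) {n u w : V} (hn : n ∈ N) (hu : u ∈ N)
    (hw : w ∈ N) (hnu : n ≠ u) (hnw : n ≠ w) (huw : u ≠ w) : LinearIndependent ℝ ![n, u, w] := by
  have hnw' : LinearIndependent ℝ ![n, w] := by
    rw [LinearIndependent.pair_iff' (ne_zero_of_unit (h.unit N hN n hn))]
    intro a ha
    rcases eq_or_eq_neg_of_smul (h.unit N hN n hn) (h.unit N hN w hw) ha.symm with e | e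
    · exact hnw e.symm
    · exact h.neg_notMem hN hn (e ▸ hw)
  have key : LinearIndependent ℝ ![u, n, w] := by
    change LinearIndependent ℝ (Fin.cons u ![n, w] : Fin 3 → V)
    rw [linearIndependent_finCons]
    refine ⟨hnw', fun hmem => ?_⟩
    rw [Matrix.range_cons, Matrix.range_cons, Matrix.range_empty, Set.union_empty,
      Set.singleton_union, Submodule.mem_span_pair] at hmem
    obtain ⟨a, b, rfl⟩ := hmem
    -- For `u = a • n + b • w`, inner points of the faces `n` and `w` show `b > 0` and `a > 0`; then
    -- `u` is negative at an inner point of its own face.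
    obtain ⟨fn, -, hfn, hfn'⟩ := h.facet N hN n hn
    obtain ⟨fw, -, hfw, hfw'⟩ := h.facet N hN w hw
    obtain ⟨fu, -, hfu, hfu'⟩ := h.facet N hN _ hu
    have h1 := hfn' _ hu hnu.symm
    have h2 := hfn' w hw hnw.symm
    have h3 := hfw' _ hu huw
    have h4 := hfw' n hn hnw
    have h5 := hfu' n hn hnu
    have h6 := hfu' w hw huw.symm
    simp only [mink_add_left, mink_smul_left, hfn, hfw, mul_zero, zero_add, add_zero] at h1 h3 hfu
    nlinarith [pos_of_mul_neg_left h1 h2.le, pos_of_mul_neg_left h3 h4.le]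
  have := key.comp ![1, 0, 2] (by decide)
  convert this using 1
  ext i; fin_cases i <;> rfl

theorem mem_of_mem_tileCone {N : Set V} (hN : N ∈ 𝒯) {x : V} (hx : x ∈ tileCone N) : x ∈ K :=
  (h.cover x hx.1).2 ⟨N, hN, hx⟩

theorem mem_nhds_of_interior {N : Set V} (hN : N ∈ 𝒯) {x : V} (hx : x ∈ future)
    (hx' : ∀ n ∈ N, mink n x < 0) : K ∈ 𝓝 x := by
  refine mem_of_superset ((isOpen_interior_tileCone (h.finite_normals N hN)).mem_nhds ⟨hx, hx'⟩) ?_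
  exact fun y hy => h.mem_of_mem_tileCone hN ⟨hy.1, fun n hn => (hy.2 n hn).le⟩

theorem add_mem_nhds {x y : V} (hx : K ∈ 𝓝 x) (hy : y ∈ K) : K ∈ 𝓝 (x + y) := by
  have : Tendsto (fun z : V => z - y) (𝓝 (x + y)) (𝓝 x) := by
    have := (continuous_sub_right y).tendsto (x + y)
    rwa [add_sub_cancel_right] at this
  filter_upwards [this hx] with z hz
  have := h.add_mem _ hz _ hy
  rwa [sub_add_cancel] at this

/-! ### The fan of tiles around an edge -/

/-- Around a generic point `x` of an edge, the tiles are obtained from each other by rotating. -/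
theorem exists_rotation {N : Set V} (hN : N ∈ 𝒯) {p u x : V} (hp : p ∈ N) (hu : u ∈ N) (hpu : p ≠ u)
    (hx : x ∈ future) (hpx : mink p x = 0) (hux : mink u x = 0)
    (hother : ∀ l ∈ N, l ≠ p → l ≠ u → mink l x < 0)
    (hK : ∀ᶠ z in 𝓝 x, mink p z < 0 → K ∈ 𝓝 z) :
    ∃ (k : ℕ) (q : V), 2 ≤ k ∧ mink p q = 0 ∧ mink q q = 1 ∧
      -u = Real.cos (Real.pi / k) • p + Real.sin (Real.pi / k) • q ∧
      ∀ j : ℕ, j < k → ∃ M ∈ 𝒯, x ∈ tileCone M ∧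
        Real.cos (j * (Real.pi / k)) • p + Real.sin (j * (Real.pi / k)) • q ∈ M ∧
        -(Real.cos ((j + 1) * (Real.pi / k)) • p + Real.sin ((j + 1) * (Real.pi / k)) • q) ∈ M ∧
        ∀ l ∈ M, l ≠ Real.cos (j * (Real.pi / k)) • p + Real.sin (j * (Real.pi / k)) • q →
          l ≠ -(Real.cos ((j + 1) * (Real.pi / k)) • p +
            Real.sin ((j + 1) * (Real.pi / k)) • q) → mink l x < 0 := by
  obtain ⟨k, hk, hang⟩ := h.angle N hN p hp u hu hpu x hx hpx hux hother
  have hpp := h.unit N hN p hp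
  have huu := h.unit N hN u hu
  have hk0 : (0 : ℝ) < k := by exact_mod_cast (by omega : 0 < k)
  set α := Real.pi / k with hα
  have hkα : k * α = Real.pi := by rw [hα]; field_simp
  have hα0 : 0 < α := div_pos Real.pi_pos hk0
  have hαpi : α < Real.pi := by
    rw [← hkα]
    have : (2 : ℝ) ≤ k := by exact_mod_cast hk
    nlinarith
  have hsin : 0 < Real.sin α := Real.sin_pos_of_pos_of_lt_pi hα0 hαpi
  have hsc := Real.sin_sq_add_cos_sq α
  -- Gram-Schmidt: `p, q` is an orthonormal basis of the span of `p` and `u`, with `-u` at angle `α`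
  -- from `p`. The normals of the `j`-th tile of the fan will be those at the angles `j * α` and,
  -- negated, `(j + 1) * α`.
  let q : V := (Real.sin α)⁻¹ • (-u - Real.cos α • p)
  have hq : Real.sin α • q = -u - Real.cos α • p := by
    simp only [q, smul_smul, mul_inv_cancel₀ hsin.ne', one_smul]
  have hpq : mink p q = 0 := by
    have : Real.sin α * mink p q = 0 := by
      rw [← mink_smul_right, hq]; simp [hpp, hang]
    exact (mul_eq_zero.1 this).resolve_left hsin.ne'
  have hqq : mink q q = 1 := by
    have : Real.sin α ^ 2 * mink q q = Real.sin α ^ 2 * 1 := by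
      have : Real.sin α ^ 2 * mink q q = mink (Real.sin α • q) (Real.sin α • q) := by
        simp; ring
      rw [this, hq]; simp [hpp, huu, hang, mink_comm u p]; nlinarith
    exact mul_left_cancel₀ (pow_ne_zero 2 hsin.ne') this
  have hu' : -u = Real.cos α • p + Real.sin α • q := by rw [hq]; module
  have hu'' : -(Real.cos α • p + Real.sin α • q) = u := by rw [← hu', neg_neg]
  have hqx : mink q x = 0 := by simp [q, hux, hpx]
  refine ⟨k, q, hk, hpq, hqq, hu', fun j => ?_⟩
  induction j with
  | zero =>
    intro _
    refine ⟨N, hN, ⟨hx, fun l hl => ?_⟩, by simpa using hp, ?_, ?_⟩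
    · by_cases h1 : l = p
      · rw [h1, hpx]
      by_cases h2 : l = u
      · rw [h2, hux]
      exact (hother l hl h1 h2).le
    · simpa only [Nat.cast_zero, zero_add, one_mul, ← hα, hu''] using hu
    · intro l hl h1 h2
      refine hother l hl (by simpa using h1) 
        (by simpa only [Nat.cast_zero, zero_add, one_mul, ← hα, hu''] using h2)
  | succ j ih =>
    intro hj
    obtain ⟨M, hM, hxM, hc, hc', hoth⟩ := ih (by omega)
    set c : ℝ → V := fun t => Real.cos t • p + Real.sin t • q with hcdef
    change c (j * α) ∈ M at hc
    change -c ((j + 1) * α) ∈ M at hc'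
    change ∀ l ∈ M, l ≠ c (j * α) → l ≠ -c ((j + 1) * α) → mink l x < 0 at hoth
    have hcc : ∀ s t, mink (c s) (c t) = Real.cos (s - t) := by
      intro s t
      simp only [c, mink_add_left, mink_add_right, mink_smul_left, mink_smul_right, hpp, hqq, hpq,
        mink_comm q p, Real.cos_sub]
      ring
    have hcx : ∀ t, mink (c t) x = 0 := fun t => by simp [c, hpx, hqx]
    -- The next tile is the mirror image of `M` in its second face. A neighbour is guaranteed only
    -- at interior points of the body, so `x` is pushed a little into this face, towards `f`.
    obtain ⟨f, hf, hf0, hfM⟩ := h.facet M hM _ hc'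
    have hne : c (j * α) ≠ -c ((j + 1) * α) := by
      intro e
      have : mink (c (j * α)) (c ((j + 1) * α)) = -1 := by
        rw [e, mink_neg_left, hcc]; simp
      rw [hcc, show (j : ℝ) * α - (j + 1) * α = -α by ring, Real.cos_neg] at this
      nlinarith
    -- The pushed point lies strictly inside `p` because `sin ((j + 1) * α) > 0`. This is where `j +
    -- 1 < k` is needed: after `k` tiles the plane of `p` is reached again.
    have hpf : mink p f < 0 := by
      have h1 := hfM _ hc hne
      have h2 : Real.sin α • p = Real.sin ((j + 1) * α) • c (j * α) -
          Real.sin (j * α) • c ((j + 1) * α) := by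
        have e : (j + 1) * α = j * α + α := by ring
        simp only [c, e, Real.sin_add, Real.cos_add]
        have := Real.sin_sq_add_cos_sq (j * α)
        have e1 : Real.sin α = Real.sin α * (Real.sin (j * α) ^ 2 + Real.cos (j * α) ^ 2) := by
          rw [this, mul_one]
        conv_lhs => rw [e1]
        module
      have h3 : Real.sin α * mink p f = Real.sin ((j + 1) * α) * mink (c (j * α)) f := by
        rw [← mink_smul_left, h2]
        simp only [mink_neg_left, neg_eq_zero] at hf0
        simp [hf0]
      have h4 : 0 < Real.sin ((j + 1) * α) := by
        apply Real.sin_pos_of_pos_of_lt_pi (by positivity)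
        rw [← hkα]
        have : ((j + 1 : ℕ) : ℝ) < k := by exact_mod_cast hj
        push_cast at this
        exact mul_lt_mul_of_pos_right this hα0
      have h5 : Real.sin α * mink p f < 0 := by
        rw [h3]; exact mul_neg_of_pos_of_neg h4 h1
      exact (pos_iff_neg_of_mul_neg h5).1 hsin
    have hev := eventually_mem_tileCone (h.finite_normals M hM) (y := f) hxM fun l hl _ => by
      by_cases hl' : l = -c ((j + 1) * α)
      · rw [hl', hf0]
      · exact (hfM l hl hl').le
    obtain ⟨ε, ⟨hε1, hε2⟩, hε0⟩ := ((hev.and (tendsto_line x f hK)).and eventually_pos_right).exists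
    have hnb := h.neighbor M hM _ hc' _ hε1 (by
        rw [mink_add_right, mink_smul_right, hf0, mink_neg_left, hcx]; simp)
      (hε2 (by
        rw [mink_add_right, hpx, mink_smul_right, zero_add]
        exact mul_neg_of_pos_of_neg hε0 hpf))
    have hunit : mink (-c ((j + 1) * α)) (-c ((j + 1) * α)) = 1 := by simp [hcc]
    have himg : refl (-c ((j + 1) * α)) (c (j * α)) = -c ((j + 1 + 1) * α) := by
      rw [refl_neg_left, refl, hcc, show ((j : ℝ) + 1) * α - j * α = α by ring]
      have e1 : (j + 1 + 1 : ℝ) * α = (j + 1) * α + α := by ring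
      have e2 : (j : ℝ) * α = (j + 1) * α - α := by ring
      simp only [c, e1, e2, Real.sin_add, Real.cos_add, Real.sin_sub, Real.cos_sub]
      module
    have himg' : refl (-c ((j + 1) * α)) (-c ((j + 1) * α)) = c ((j + 1) * α) := by
      rw [refl_self hunit, neg_neg]
    have hrx : refl (-c ((j + 1) * α)) x = x := refl_of_mink_eq_zero (by simp [hcx])
    have hin : ∀ l, mink (refl (-c ((j + 1) * α)) l) x = mink l x := fun l => by
      rw [mink_refl_left, hrx]
    refine ⟨_, hnb, ⟨hx, ?_⟩, ?_, ?_, ?_⟩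
    · rintro _ ⟨l, hl, rfl⟩
      rw [hin]; exact hxM.2 l hl
    · push_cast
      exact ⟨_, hc', himg'⟩
    · push_cast
      exact ⟨_, hc, himg⟩
    · rintro _ ⟨l, hl, rfl⟩ h1 h2
      push_cast at h1 h2
      rw [hin]
      refine hoth l hl ?_ ?_
      · rintro rfl; exact h2 himg
      · rintro rfl; exact h1 himg'

end IsTileSystem

/-! ### Walls do not cut tiles -/

theorem linearIndependent_neg_first {n u w : V} (h : LinearIndependent ℝ ![-n, u, w]) :
    LinearIndependent ℝ ![n, u, w] := by
  have := h.units_smul ![-1, 1, 1]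
  convert this using 1
  ext i; fin_cases i <;> simp

/-- The first exit of a ray from the cone of a tile. -/
theorem exists_exit {N : Set V} (hN : N.Finite) {x g : V} (hx : x ∈ future)
    (hg : g ∈ future) (hxN : ∀ l ∈ N, 0 < mink l g → mink l x < 0)
    (hxN' : ∀ l ∈ N, mink l x ≤ 0)
    (hex : ∃ l ∈ N, 0 < mink l g) :
    ∃ t : ℝ, 0 < t ∧ x + t • g ∈ tileCone N ∧ ∃ l ∈ N, 0 < mink l g ∧ mink l (x + t • g) = 0 := by
  obtain ⟨u, ⟨hu, hug⟩, hmin⟩ := Set.exists_min_image {l | l ∈ N ∧ 0 < mink l g}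
    (fun l => -mink l x / mink l g) (hN.subset fun l hl => hl.1) hex
  have ht : 0 < -mink u x / mink u g := div_pos (neg_pos.2 (hxN u hu hug)) hug
  refine ⟨_, ht, ⟨future_add_smul ht.le hx hg, fun l hl => ?_⟩, u, hu, hug, ?_⟩
  · rw [mink_add_right, mink_smul_right]
    rcases le_or_gt (mink l g) 0 with hlg | hlg
    · have := hxN' l hl
      nlinarith [mul_nonpos_of_nonneg_of_nonpos ht.le hlg]
    · have := hmin l ⟨hl, hlg⟩
      rw [le_div_iff₀ hlg] at this
      linarith
  · rw [mink_add_right, mink_smul_right, div_mul_cancel₀ _ hug.ne']; ring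

namespace IsTileSystem

variable {K : Set V} {𝒯 : Set (Set V)} (h : IsTileSystem K 𝒯)
include h

theorem smul_mem_of_mem_tileCone {N : Set V} (hN : N ∈ 𝒯) {x y : V} (hx : K ∈ 𝓝 x)
    (hy : y ∈ tileCone N) {t : ℝ} (ht : 0 ≤ t) : K ∈ 𝓝 (x + t • y) := by
  rcases ht.eq_or_lt with rfl | ht
  · simpa using hx
  · exact h.add_mem_nhds hx (h.mem_of_mem_tileCone hN (tileCone_smul hy ht))

/-- The plane of a face of a tile does not meet the interior of any tile. -/
theorem mink_ne_zero_of_interior {N G : Set V} (hN : N ∈ 𝒯) {n : V} (hn : n ∈ N) (hG : G ∈ 𝒯)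
    {y : V} (hy : y ∈ future) (hyG : ∀ m ∈ G, mink m y < 0) : mink n y ≠ 0 := by
  intro hny
  have hnn := h.unit N hN n hn
  obtain ⟨x₀, hx₀, hnx₀, hx₀N⟩ := h.facet N hN n hn
  have hx₀N' : x₀ ∈ tileCone N := ⟨hx₀, fun l hl => by
    by_cases e : l = n
    · rw [e, hnx₀]
    · exact (hx₀N l hl e).le⟩
  -- The starting point is perturbed within the plane of `n` so that the ray towards `x₀` crosses
  -- edges only at their generic points.
  obtain ⟨y', hy', hny', hyG', hgen⟩ := exists_generic (h.finite_normals G hG) h.finite_walls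
    (ne_zero_of_unit hnn) hnx₀ hy hny hyG
  clear hny hyG hy
  -- The parameters at which the ray from `y'` in direction `x₀` lies in a tile having a face in the
  -- plane of `n`. The least one leads to a contradiction: the property can be continued backwards
  -- towards `y'`.
  let S : Set ℝ := ⋃ M ∈ {M | M ∈ 𝒯 ∧ (n ∈ M ∨ -n ∈ M)}, {t | 0 ≤ t ∧ ∀ m ∈ M,
    mink m (y' + t • x₀) ≤ 0}
  have hS : IsClosed S := by
    refine (h.finite.subset fun M hM => hM.1).isClosed_biUnion fun M _ => ?_
    refine isClosed_Ici.inter ?_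
    change IsClosed {t : ℝ | ∀ m ∈ M, mink m (y' + t • x₀) ≤ 0}
    simp only [Set.ofPred_forall]
    exact isClosed_biInter fun m _ => isClosed_le (by fun_prop) continuous_const
  have hmemS : ∀ M ∈ 𝒯, (n ∈ M ∨ -n ∈ M) → ∀ t, 0 ≤ t → y' + t • x₀ ∈ tileCone M → t ∈ S :=
    fun M hM hnM t ht htM => Set.mem_biUnion (show M ∈ _ from ⟨hM, hnM⟩) ⟨ht, htM.2⟩
  have hSne : S.Nonempty := by
    obtain ⟨ε, hε, hε0⟩ := ((eventually_mem_tileCone (h.finite_normals N hN) (y := y') hx₀N'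
      fun l hl hlx => by
        by_cases e : l = n
        · rw [e, hny']
        · exact absurd hlx (hx₀N l hl e).ne).and eventually_pos_right).exists
    -- For large parameters the direction of the point approaches `x₀`, an inner point of the face
    -- `n` of `N`.
    refine ⟨ε⁻¹, hmemS N hN (Or.inl hn) _ (inv_pos.2 hε0).le ?_⟩
    convert tileCone_smul hε (inv_pos.2 hε0) using 1
    rw [smul_add, smul_smul, inv_mul_cancel₀ hε0.ne', one_smul, add_comm]
  have hSb : BddBelow S := ⟨0, fun t ht => by
    obtain ⟨M, _, ht⟩ := Set.mem_iUnion₂.1 ht; exact ht.1⟩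
  have hmem := hS.csInf_mem hSne hSb
  set t := sInf S with ht
  obtain ⟨M, ⟨hM, hnM⟩, ht0, htM⟩ := Set.mem_iUnion₂.1 hmem
  set x := y' + t • x₀ with hx
  have hxf : x ∈ future := future_add_smul ht0 hy' hx₀
  have hxM : x ∈ tileCone M := ⟨hxf, htM⟩
  have hnx : mink n x = 0 := by simp [hx, hny', hnx₀]
  -- At parameter `0` the tile `M` would meet the interior of `G`, hence equal `G`; but `y'` lies on
  -- a face plane of `M` and on none of `G`.
  have htpos : 0 < t := by
    refine lt_of_le_of_ne ht0 fun e => ?_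
    have hxy : x = y' := by rw [hx, ← e]; simp
    obtain ⟨c, hc, hcM⟩ := h.inner M hM
    obtain ⟨ε, h1, h2⟩ := ((eventually_interior_tileCone (h.finite_normals M hM) hxM
      fun l hl _ => hcM l hl).and (eventually_interior_tileCone (h.finite_normals G hG) (y := c)
      ⟨hy', fun l hl => (hyG' l hl).le⟩ fun l hl h0 => absurd h0 (hyG' l hl).ne)).exists
    have := h.disjoint M hM G hG _ h1.1 h1.2 (hxy ▸ h2.2)
    subst this
    rcases hnM with h' | h'
    · exact (hyG' _ h').ne hny'
    · exact (hyG' _ h').ne (by simp [hny'])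
  -- By minimality of `t`, no tile at `x` with a face in this plane contains points slightly closer
  -- to `y'`: up to scaling, `x + ε • y'` is the point of the ray with parameter `t / (1 + ε)`.
  have step : ∀ M ∈ 𝒯, (n ∈ M ∨ -n ∈ M) → x ∈ tileCone M →
      ¬∀ l ∈ M, mink l x = 0 → mink l y' ≤ 0 := by
    intro M hM hnM hxM hl
    obtain ⟨ε, hε, hε0⟩ := ((eventually_mem_tileCone (h.finite_normals M hM) hxM hl).and
      eventually_pos_right).exists
    have h1 : (0 : ℝ) < 1 + ε := by linarith
    have h2 : t / (1 + ε) ∈ S := by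
      refine hmemS M hM hnM _ (div_nonneg ht0 h1.le) ?_
      convert tileCone_smul hε (inv_pos.2 h1) using 1
      rw [hx]
      have e1 : (1 + ε)⁻¹ * (1 + ε) = 1 := inv_mul_cancel₀ h1.ne'
      have e2 : y' = ((1 + ε)⁻¹ * (1 + ε)) • y' := by rw [e1, one_smul]
      conv_lhs => rw [e2]
      rw [div_eq_inv_mul]; module
    have h3 := csInf_le hSb h2
    have h4 : t / (1 + ε) < t := div_lt_self htpos (by linarith)
    exact absurd h3 (not_le.2 h4)
  have hns := step M hM hnM hxM
  push Not at hns
  obtain ⟨u, hu, hux, huy⟩ := hns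
  have hKx : K ∈ 𝓝 x := h.smul_mem_of_mem_tileCone hN (h.mem_nhds_of_interior hG hy' hyG') hx₀N' ht0
  obtain ⟨p, hp, hpn⟩ : ∃ p ∈ M, p = n ∨ p = -n := by
    rcases hnM with h' | h'
    · exact ⟨n, h', Or.inl rfl⟩
    · exact ⟨-n, h', Or.inr rfl⟩
  have hpx : mink p x = 0 := by rcases hpn with rfl | rfl <;> simp [hnx]
  have hpy : mink p y' = 0 := by rcases hpn with rfl | rfl <;> simp [hny']
  have hpu : p ≠ u := by rintro rfl; exact huy.ne' hpy
  obtain ⟨k, q, hk, hpq, hqq, hpuq, hrot⟩ := h.exists_rotation hM hp hu hpu hxf hpx hux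
    (fun l hl hlp hlu => by
      refine lt_of_le_of_ne (hxM.2 l hl) fun hlx => ?_
      refine hgen u (mem_walls hM hu) l (mem_walls hM hl) t hux hlx ?_
      have := h.linearIndependent_of_ne hM hp hu hl hpu hlp.symm hlu.symm
      rcases hpn with rfl | rfl
      · exact this
      · exact linearIndependent_neg_first this)
    ((eventually_mem_nhds_iff.2 hKx).mono fun z hz _ => hz)
  -- The last tile of the fan again has `p` as a normal, since the negated vector at angle `π` is
  -- `p`. Its other normal at `x` takes at `y'` the value opposite to that of `u`, so this tile does
  -- continue towards `y'`, against `step`.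
  obtain ⟨M', hM', hxM', hc, hc', hoth⟩ := hrot (k - 1) (by omega)
  have hk0 : (0 : ℝ) < k := by exact_mod_cast (by omega : 0 < k)
  have e1 : (((k - 1 : ℕ) : ℝ) + 1) * (Real.pi / k) = Real.pi := by
    rw [Nat.cast_sub (by omega)]; push_cast; field_simp; ring
  have e2 : ((k - 1 : ℕ) : ℝ) * (Real.pi / k) = Real.pi - Real.pi / k := by linarith
  rw [e1] at hc' hoth
  rw [e2] at hc hoth
  have e3 : -(Real.cos Real.pi • p + Real.sin Real.pi • q) = p := by simp
  rw [e3] at hc' hoth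
  rw [Real.cos_pi_sub, Real.sin_pi_sub] at hc hoth
  refine step M' hM' ?_ hxM' fun l hl hlx => ?_
  · rcases hpn with rfl | rfl
    · exact Or.inl hc'
    · exact Or.inr hc'
  · by_cases hl1 : l = p
    · rw [hl1, hpy]
    by_cases hl2 : l = -Real.cos (Real.pi / k) • p + Real.sin (Real.pi / k) • q
    · have := congrArg (fun v => mink v y') hpuq
      simp only [mink_neg_left, mink_add_left, mink_smul_left, hpy, mul_zero, zero_add] at this
      rw [hl2]
      simp only [mink_add_left, mink_smul_left, hpy, mul_zero, zero_add, ← this]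
      linarith
    · exact absurd hlx (hoth l hl hl2 hl1).ne

theorem mink_wall_ne_zero {m : V} (hm : m ∈ walls 𝒯) {G : Set V} (hG : G ∈ 𝒯) {y : V}
    (hy : y ∈ future) (hyG : ∀ l ∈ G, mink l y < 0) : mink m y ≠ 0 := by
  obtain ⟨N, hN, hmN | hmN⟩ := hm
  · exact h.mink_ne_zero_of_interior hN hmN hG hy hyG
  · simpa using h.mink_ne_zero_of_interior hN hmN hG hy hyG

/-- A wall does not separate two points of a tile. -/
theorem tileCone_side {m : V} (hm : m ∈ walls 𝒯) {G : Set V} (hG : G ∈ 𝒯) :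
    (∀ v ∈ tileCone G, mink m v ≤ 0) ∨ ∀ v ∈ tileCone G, 0 ≤ mink m v := by
  by_contra hcon
  push Not at hcon
  obtain ⟨⟨v, hv, hmv⟩, w, hw, hmw⟩ := hcon
  obtain ⟨c, hc, hcG⟩ := h.inner G hG
  have hf := h.finite_normals G hG
  -- Both points are pushed into the interior without changing sides; the segment between them then
  -- crosses the wall at an interior point of the tile.
  obtain ⟨ε, hε, hε'⟩ := ((eventually_interior_tileCone hf hv fun l hl _ => hcG l hl).and
    (eventually_mink_neg (n := -m) (x := v) (by simpa using hmv) c)).exists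
  obtain ⟨δ, hδ, hδ'⟩ := ((eventually_interior_tileCone hf hw fun l hl _ => hcG l hl).and
    (eventually_mink_neg hmw c)).exists
  rw [mink_neg_left, neg_lt_zero] at hε'
  generalize v + ε • c = a at *
  generalize w + δ • c = b at *
  refine h.mink_wall_ne_zero hm hG (y := (-mink m b) • a + (mink m a) • b)
    (future_add (future_smul (neg_pos.2 hδ') hε.1) (future_smul hε' hδ.1)) (fun l hl => ?_) ?_
  · simp only [mink_add_right, mink_smul_right]
    have h1 := mul_neg_of_pos_of_neg (neg_pos.2 hδ') (hε.2 l hl)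
    have h2 := mul_neg_of_pos_of_neg hε' (hδ.2 l hl)
    linarith
  · simp only [mink_add_right, mink_smul_right]; ring

/-! ### Acute-angledness of the tiles -/

/-- Different outer normals of a tile have non-positive products. -/
theorem mink_nonpos {N : Set V} (hN : N ∈ 𝒯) {n m : V} (hn : n ∈ N) (hm : m ∈ N) (hnm : n ≠ m) :
    mink n m ≤ 0 := by
  by_contra hpos
  push Not at hpos
  have hnn := h.unit N hN n hn
  obtain ⟨fm, hfm, hmfm, hfmN⟩ := h.facet N hN m hm
  obtain ⟨fn, hfn, hnfn, hfnN⟩ := h.facet N hN n hn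
  have hfmN' : ∀ l ∈ N, mink l fm ≤ 0 := fun l hl => by
    by_cases e : l = m
    · rw [e, hmfm]
    · exact (hfmN l hl e).le
  have hnfm := hfmN n hn hnm
  -- The orthogonal projection to the plane of `n` of an inner point of the face `m`. If `mink n m >
  -- 0`, it lies beyond `m`, so a ray towards it inside the face `n` must leave the tile,
  -- generically at an inner point of an edge.
  set g := fm - mink n fm • n with hg
  have hgn : mink n g = 0 := by simp [hg, hnn]
  have hgf : g ∈ future := by
    have h1 := hfm.1
    refine future_of_timelike hfm ?_ ?_ <;>
      simp only [hg, mink_sub_left, mink_sub_right, mink_smul_left, mink_smul_right, hnn,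
        mink_comm fm n] <;> nlinarith [mul_self_nonneg (mink n fm)]
  have hgl : ∀ l, mink l g = mink l fm - mink n fm * mink n l := fun l => by
    simp [hg, mink_comm l n]
  have hgm : 0 < mink m g := by
    rw [hgl, hmfm]; nlinarith
  obtain ⟨f, hf, hnf, hfN, hgen⟩ := exists_generic (M := N \ {n})
    ((h.finite_normals N hN).sdiff) h.finite_walls (ne_zero_of_unit hnn) hgn hfn hnfn
    (fun l hl => hfnN l hl.1 hl.2)
  obtain ⟨t, ht, hxN, u, hu, hug, hux⟩ := exists_exit (h.finite_normals N hN) hf hgf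
    (fun l hl hlg => hfN l ⟨hl, fun e => by rw [e, hgn] at hlg; exact lt_irrefl _ hlg⟩)
    (fun l hl => by
      by_cases e : l = n
      · rw [e, hnf]
      · exact (hfN l ⟨hl, e⟩).le) ⟨m, hm, hgm⟩
  have hnu : n ≠ u := by rintro rfl; exact hug.ne' hgn
  obtain ⟨k, hk, hk'⟩ := h.angle N hN n hn u hu hnu _ hxN.1 (by simp [hnf, hgn]) hux
    (fun l hl hln hlu => by
      refine lt_of_le_of_ne (hxN.2 l hl) fun hlx => ?_
      exact hgen u (mem_walls hN hu) l (mem_walls hN hl) t hux hlx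
        (h.linearIndependent_of_ne hN hn hu hl hnu hln.symm hlu.symm))
  have hcos : 0 ≤ Real.cos (Real.pi / k) := by
    apply Real.cos_nonneg_of_neg_pi_div_two_le_of_le
    · have : 0 ≤ Real.pi / k := by positivity
      linarith [Real.pi_pos]
    · exact div_le_div_of_nonneg_left Real.pi_pos.le two_pos (by exact_mod_cast hk)
  -- The angle at the exit edge is at most `π / 2`, so projecting to the plane of `n` cannot
  -- increase the value of `u`; thus `g` is not beyond the exit face `u`.
  rw [hgl, hk'] at hug
  have := hfmN' u hu
  nlinarith

end IsTileSystem

/-! ### Reflecting walls in walls that bound the body locally -/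

theorem mem_span_pair_of_perp_le {p q m : V}
    (h : ∀ v, mink p v = 0 → mink q v = 0 → mink m v = 0) : ∃ a b : ℝ, m = a • p + b • q := by
  have hm : m ∈ minkForm.orthogonal (perp {p, q}) := fun v hv => by
    change mink v m = 0
    rw [mem_perp] at hv
    rw [mink_comm]; exact h v (hv p (by simp)) (hv q (by simp))
  rw [perp, LinearMap.BilinForm.orthogonal_orthogonal minkForm_nondegenerate minkForm_isRefl] at hm
  obtain ⟨a, b, hab⟩ := Submodule.mem_span_pair.1 hm
  exact ⟨a, b, hab.symm⟩

theorem not_linearIndependent_of_mem_span_pair {p q a b c : V}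
    (ha : a ∈ Submodule.span ℝ {p, q}) (hb : b ∈ Submodule.span ℝ {p, q})
    (hc : c ∈ Submodule.span ℝ {p, q}) : ¬LinearIndependent ℝ ![a, b, c] := by
  intro h
  have h1 := finrank_span_eq_card h
  have h2 : Submodule.span ℝ (Set.range ![a, b, c]) ≤ Submodule.span ℝ {p, q} := by
    rw [Submodule.span_le]
    rintro _ ⟨i, rfl⟩
    fin_cases i
    exacts [ha, hb, hc]
  have h3 := Submodule.finrank_mono h2
  have h4 : Module.finrank ℝ (Submodule.span ℝ {p, q}) ≤ 2 := by
    have := finrank_span_le_card (R := ℝ) ({p, q} : Set V)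
    refine this.trans ?_
    rw [Set.toFinset_insert, Set.toFinset_singleton]
    exact Finset.card_le_two
  rw [h1] at h3
  simp at h3
  omega

/-- A ray that starts inside the body starts inside one of the tiles. -/
theorem exists_tile_along {K : Set V} {𝒯 : Set (Set V)} (hfin : 𝒯.Finite)
    (hcov : ∀ v ∈ future, v ∈ K → ∃ N ∈ 𝒯, v ∈ tileCone N) {y d : V} (hy : y ∈ future)
    (hK : ∀ᶠ ε : ℝ in 𝓝[>] 0, y + ε • d ∈ K) :
    ∃ N ∈ 𝒯, y ∈ tileCone N ∧ ∃ᶠ ε : ℝ in 𝓝[>] 0, y + ε • d ∈ tileCone N := by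
  obtain ⟨N, hN, hfr⟩ : ∃ N ∈ 𝒯, ∃ᶠ ε : ℝ in 𝓝[>] 0, y + ε • d ∈ tileCone N := by
    by_contra hcon
    push Not at hcon
    obtain ⟨ε, h1, h2, h3⟩ := (((eventually_all_finite hfin).2 hcon).and
      (hK.and (eventually_future hy d))).exists
    obtain ⟨N, hN, h4⟩ := hcov _ h3 h2
    exact h1 N hN h4
  refine ⟨N, hN, ⟨hy, fun l hl => ?_⟩, hfr⟩
  by_contra hly
  push Not at hly
  have hev := eventually_mink_neg (n := -l) (x := y) (by simpa using hly) d
  obtain ⟨ε, h1, h2⟩ := (hfr.and_eventually hev).exists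
  have := h1.2 l hl
  rw [mink_neg_left] at h2
  linarith

namespace IsTileSystem

variable {K : Set V} {𝒯 : Set (Set V)} (h : IsTileSystem K 𝒯)
include h

/-- The tiles that miss `x` are relatively closed in `future` and finite in number, so near `x` only
tiles through `x` occur. -/
theorem eventually_notMem_tileCone {x : V} (hx : x ∈ future) :
    ∀ᶠ z in 𝓝 x, ∀ N ∈ 𝒯, z ∈ tileCone N → x ∈ tileCone N := by
  refine (eventually_all_finite h.finite).2 fun N hN => ?_
  by_cases hxN : x ∈ tileCone N
  · exact Eventually.of_forall fun _ _ => hxN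
  · have : ∃ l ∈ N, 0 < mink l x := by
      by_contra hcon
      push Not at hcon
      exact hxN ⟨hx, hcon⟩
    obtain ⟨l, hl, hlx⟩ := this
    have ho : IsOpen {z : V | 0 < mink l z} := isOpen_lt continuous_const (by fun_prop)
    filter_upwards [ho.mem_nhds hlx] with z hz hzN
    exact absurd (hzN.2 l hl) (not_le.2 hz)

theorem eventually_mink_neg_of_neg (x : V) :
    ∀ᶠ z in 𝓝 x, ∀ N ∈ 𝒯, ∀ l ∈ N, mink l x < 0 → mink l z < 0 := by
  refine (eventually_all_finite h.finite).2 fun N hN =>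
    (eventually_all_finite (h.finite_normals N hN)).2 fun l hl => ?_
  by_cases hlx : mink l x < 0
  · have ho : IsOpen {z : V | mink l z < 0} := isOpen_lt (by fun_prop) continuous_const
    filter_upwards [ho.mem_nhds hlx] with z hz _ using hz
  · exact Eventually.of_forall fun _ h' => absurd h' hlx

/-- On a line of intersection of two walls there are points that lie only on walls of the pencil
of this line. -/
theorem exists_generic_on_line {p q x₀ : V} (hpx : mink p x₀ = 0) (hqx : mink q x₀ = 0)
    {U : Set V} (hU : U ∈ 𝓝 x₀) : ∃ x ∈ U, mink p x = 0 ∧ mink q x = 0 ∧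
      ∀ m ∈ walls 𝒯, mink m x = 0 → ∃ a b : ℝ, m = a • p + b • q := by
  obtain ⟨r, hr, hrU⟩ := Metric.mem_nhds_iff.1 hU
  let C : Set V := Metric.ball x₀ r ∩ (perp {p, q} : Set V)
  have hx₀ : x₀ ∈ perp {p, q} := by
    rw [mem_perp]; rintro n (rfl | rfl) <;> assumption
  have hC : Convex ℝ C := (convex_ball x₀ r).inter (perp {p, q}).convex
  obtain ⟨x, hx, hxm⟩ := exists_mem_forall_notMem_submodule hC
    (s := {m | m ∈ walls 𝒯 ∧ ¬∃ a b : ℝ, m = a • p + b • q})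
    (h.finite_walls.subset fun m hm => hm.1) (fun m => perp {m})
    ⟨x₀, Metric.mem_ball_self hr, hx₀⟩ (fun m hm => by
      by_cases hmx : mink m x₀ = 0
      · obtain ⟨d, hpd, hqd, hmd⟩ : ∃ d, mink p d = 0 ∧ mink q d = 0 ∧ mink m d ≠ 0 := by
          by_contra hcon
          push Not at hcon
          exact hm.2 (mem_span_pair_of_perp_le hcon)
        have hev : ∀ᶠ ε : ℝ in 𝓝[>] 0, x₀ + ε • d ∈ Metric.ball x₀ r :=
          tendsto_line x₀ d (Metric.ball_mem_nhds x₀ hr)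
        obtain ⟨ε, hε, hε0⟩ := (hev.and eventually_pos_right).exists
        refine ⟨x₀ + ε • d, ⟨hε, ?_⟩, fun hmem => ?_⟩
        · rw [SetLike.mem_coe, mem_perp]
          rintro n (rfl | rfl)
          · simp [hpx, hpd]
          · simp [hqx, hqd]
        · have := mem_perp.1 hmem m rfl
          rw [mink_add_right, mink_smul_right, hmx, zero_add] at this
          exact (mul_ne_zero hε0.ne' hmd) this
      · exact ⟨x₀, ⟨Metric.mem_ball_self hr, hx₀⟩, fun hmem => hmx (mem_perp.1 hmem m rfl)⟩)
  refine ⟨x, hrU hx.1, mem_perp.1 hx.2 p (by simp), mem_perp.1 hx.2 q (by simp), fun m hm hmx => ?_⟩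
  by_contra hcon
  exact hxm m ⟨hm, hcon⟩ (mem_perp.2 fun n hn => by rw [Set.mem_singleton_iff.1 hn]; exact hmx)

/-- If a wall `p` bounds (locally) a part of the body, the reflection in `p` maps each wall that
meets `p` there to a wall. -/
theorem refl_mem_walls {p μ x₀ : V} (hp : p ∈ walls 𝒯) (hμ : μ ∈ walls 𝒯) (hne : μ ≠ p)
    (hne' : μ ≠ -p) (hx₀ : x₀ ∈ future) (hpx₀ : mink p x₀ = 0) (hμx₀ : mink μ x₀ = 0)
    (hK₀ : ∀ᶠ z in 𝓝 x₀, mink p z ≤ 0 → z ∈ K) : refl p μ ∈ walls 𝒯 := by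
  -- After moving along the intersection of `p` and `μ`, every wall through `x` belongs to the
  -- pencil of this line, and the problem becomes two-dimensional.
  obtain ⟨x, ⟨hx, hK⟩, hpx, hμx, hgen⟩ := h.exists_generic_on_line hpx₀ hμx₀
    (U := {x | x ∈ future ∧ ∀ᶠ z in 𝓝 x, mink p z ≤ 0 → z ∈ K})
    (Eventually.and (isOpen_future.eventually_mem hx₀) (eventually_eventually_nhds.2 hK₀))
  clear hx₀ hpx₀ hμx₀ hK₀
  have hpp := h.unit_of_wall hp
  have hμμ := h.unit_of_wall hμ
  have hspan : ∀ m ∈ walls 𝒯, mink m x = 0 → m ∈ Submodule.span ℝ {p, μ} := fun m hm hmx => by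
    obtain ⟨a, b, e⟩ := hgen m hm hmx
    exact Submodule.mem_span_pair.2 ⟨a, b, e.symm⟩
  have hpm : mink p μ ^ 2 < 1 := by
    have := mink_self_pos (y := μ - mink p μ • p) hx
      (by simp [mink_comm x, hpx, hμx]) (fun e => by
        rcases eq_or_eq_neg_of_smul hpp hμμ (sub_eq_zero.1 e) with e | e
        · exact hne e
        · exact hne' e)
    simp only [mink_sub_left, mink_sub_right, mink_smul_left, mink_smul_right, hpp, hμμ,
      mink_comm μ p] at this
    nlinarith
  -- a tile with face `p` at `x`
  obtain ⟨N, hN, hpN, hxN⟩ : ∃ N ∈ 𝒯, p ∈ N ∧ x ∈ tileCone N := by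
    -- The direction `d` runs in the plane of `p` and leaves the line. The required tile is the one
    -- just inside `p` at a nearby point `y` in this direction.
    set d := μ - mink p μ • p with hd
    have hpd : mink p d = 0 := by simp [hd, hpp]
    have hμd : 0 < mink μ d := by
      simp only [hd, mink_sub_right, mink_smul_right, hμμ, mink_comm μ p]; nlinarith
    have hev := ((eventually_eventually_nhds.2 hK).and ((h.eventually_notMem_tileCone hx).and
      (h.eventually_mink_neg_of_neg x)))
    obtain ⟨ε, ⟨⟨h1, h2, h3⟩, hε0⟩, hyf⟩ := (((tendsto_line x d).eventually hev).and
      eventually_pos_right |>.and (eventually_future hx d)).exists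
    set y := x + ε • d with hy
    have hpy : mink p y = 0 := by simp [hy, hpx, hpd]
    obtain ⟨N, hN, hyN, hfr⟩ := exists_tile_along h.finite
      (fun v hv => (h.cover v hv).1) (d := -p) hyf (by
      filter_upwards [(tendsto_line y (-p)).eventually h1, eventually_pos_right] with δ hδ hδ0
      refine hδ ?_
      simp [hpy, hpp, hδ0.le])
    have hside : ∀ v ∈ tileCone N, mink p v ≤ 0 := by
      refine (h.tileCone_side hp hN).resolve_right fun hcon => ?_
      obtain ⟨δ, hδ, hδ0⟩ := (hfr.and_eventually eventually_pos_right).exists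
      have := hcon _ hδ
      simp [hpy, hpp] at this
      linarith
    refine ⟨N, hN, ?_, h2 N hN hyN⟩
    -- Otherwise `y` would be interior to `N`: a wall `a • p + b • μ` through `x` vanishes at `y`
    -- only for `b = 0`, so it is `p` or `-p`, and `-p` is on the wrong side.
    by_contra hpN
    refine h.mink_wall_ne_zero hp hN hyf (fun l hl => ?_) hpy
    rcases ((h2 N hN hyN).2 l hl).lt_or_eq with hlx | hlx
    · exact h3 N hN l hl hlx
    · refine lt_of_le_of_ne (hyN.2 l hl) fun hly => ?_
      obtain ⟨a, b, e⟩ := hgen l (mem_walls hN hl) hlx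
      have hb : b = 0 := by
        have e2 : ε * (b * mink μ d) = 0 := by
          rw [hy, mink_add_right, hlx, mink_smul_right, zero_add, e] at hly
          simpa [hpd] using hly
        rcases mul_eq_zero.1 e2 with e2 | e2
        · exact absurd e2 hε0.ne'
        · exact (mul_eq_zero.1 e2).resolve_right hμd.ne'
      rw [hb, zero_smul, add_zero] at e
      rcases eq_or_eq_neg_of_smul hpp (h.unit N hN l hl) e with e | e
      · exact hpN (e ▸ hl)
      · obtain ⟨c, hc, hcN⟩ := h.inner N hN
        have h4 := hcN l hl
        have h5 := hside c ⟨hc, fun n hn => (hcN n hn).le⟩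
        rw [e, mink_neg_left] at h4
        linarith
  obtain ⟨u, hu, hup, hux⟩ : ∃ u ∈ N, u ≠ p ∧ mink u x = 0 := by
    by_contra hcon
    push Not at hcon
    -- If `p` were the only face of `N` at `x`, the wall `μ` would enter the interior of `N`: this
    -- direction lies in the plane of `μ` and points inside `p`.
    obtain ⟨ε, hε⟩ := (eventually_interior_tileCone (h.finite_normals N hN)
      (y := mink p μ • μ - p) hxN (fun l hl hlx => by
        by_cases e : l = p
        · simp only [e, mink_sub_right, mink_smul_right, hpp]
          nlinarith
        · exact absurd hlx (hcon l hl e))).exists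
    refine h.mink_wall_ne_zero hμ hN hε.1 hε.2 ?_
    simp [hμx, hμμ, mink_comm μ p]
  have huu := h.unit N hN u hu
  obtain ⟨k, q, hk, hpq, hqq, huq, hrot⟩ := h.exists_rotation hN hpN hu hup.symm hx hpx hux
    (fun l hl hlp hlu => by
      refine lt_of_le_of_ne (hxN.2 l hl) fun hlx => ?_
      exact not_linearIndependent_of_mem_span_pair (hspan p hp hpx)
        (hspan u (mem_walls hN hu) hux) (hspan l (mem_walls hN hl) hlx)
        (h.linearIndependent_of_ne hN hpN hu hl hup.symm hlp.symm hlu.symm))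
    (by
      filter_upwards [eventually_eventually_nhds.2 hK] with z hz hpz
      have ho : IsOpen {w : V | mink p w < 0} := isOpen_lt (by fun_prop) continuous_const
      filter_upwards [hz, ho.mem_nhds hpz] with w hw hpw using hw (le_of_lt hpw))
  obtain ⟨A, B, hAB⟩ : ∃ A B : ℝ, μ = A • p + B • q := by
    obtain ⟨a, b, e⟩ := hgen u (mem_walls hN hu) hux
    have hb : b ≠ 0 := by
      rintro rfl
      rw [zero_smul, add_zero] at e
      rcases eq_or_eq_neg_of_smul hpp huu e with e | e
      · exact hup e
      · exact h.neg_notMem hN hpN (e ▸ hu)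
    have e2 : b • μ = (-a - Real.cos (Real.pi / k)) • p - Real.sin (Real.pi / k) • q := by
      have : b • μ = u - a • p := by rw [e]; module
      rw [this, show u = -(-u) by simp, huq]; module
    refine ⟨b⁻¹ * (-a - Real.cos (Real.pi / k)), -(b⁻¹ * Real.sin (Real.pi / k)), ?_⟩
    have : μ = b⁻¹ • b • μ := by rw [smul_smul, inv_mul_cancel₀ hb, one_smul]
    rw [this, e2]; module
  have key : ∀ ν ∈ walls 𝒯, ∀ A B : ℝ, 0 < B → ν = A • p + B • q → refl p ν ∈ walls 𝒯 := by
    intro ν hν A B hB hνe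
    have hνν := h.unit_of_wall hν
    have hAB1 : A ^ 2 + B ^ 2 = 1 := by
      rw [hνe] at hνν
      simp [hpp, hqq, hpq, mink_comm q p] at hνν
      nlinarith
    -- The wall `ν` sits at an angle `φ` strictly between `0` and `π`, and `j` counts the tiles of
    -- the fan before it.
    set φ := Real.arccos A with hφ
    have hcos : Real.cos φ = A := Real.cos_arccos (by nlinarith) (by nlinarith)
    have hsin : Real.sin φ = B := by
      rw [hφ, Real.sin_arccos, show 1 - A ^ 2 = B ^ 2 by linarith, Real.sqrt_sq hB.le]
    have hφ0 : 0 < φ := Real.arccos_pos.2 (by nlinarith)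
    have hφpi : φ < Real.pi := lt_of_le_of_ne (Real.arccos_le_pi A) fun e => by
      rw [e, Real.sin_pi] at hsin; exact hB.ne hsin
    have hk0 : (0 : ℝ) < k := by exact_mod_cast (by omega : 0 < k)
    set α := Real.pi / k with hα
    have hα0 : 0 < α := div_pos Real.pi_pos hk0
    have hkα : k * α = Real.pi := by rw [hα]; field_simp
    have hj1 : (⌊φ / α⌋₊ : ℝ) ≤ φ / α := Nat.floor_le (by positivity)
    have hj2 := Nat.lt_floor_add_one (φ / α)
    set j := ⌊φ / α⌋₊ with hj
    rw [le_div_iff₀ hα0] at hj1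
    rw [div_lt_iff₀ hα0] at hj2
    have hjk : j < k := by
      have : (j : ℝ) * α < k * α := by linarith
      exact_mod_cast lt_of_mul_lt_mul_right this hα0.le
    rcases hj1.eq_or_lt with hjφ | hjφ
    · have hj0 : 0 < j := by
        rcases Nat.eq_zero_or_pos j with h0 | h0
        · rw [h0] at hjφ; simp at hjφ; linarith
        · exact h0
      -- The reflection sends the angle `j * α` to `π - j * α = (k - j) * α`, once more a face of
      -- the fan. Since `j > 0`, the index `k - j` is less than `k`.
      obtain ⟨M, hM, -, hc, -⟩ := hrot (k - j) (by omega)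
      have e : ((k - j : ℕ) : ℝ) * α = Real.pi - φ := by
        rw [Nat.cast_sub hjk.le, sub_mul, hkα, hjφ]
      rw [e, Real.cos_pi_sub, Real.sin_pi_sub, hcos, hsin] at hc
      have : refl p ν = -A • p + B • q := by
        rw [hνe, refl]; simp [hpp, hpq]; module
      rw [this]
      exact mem_walls hM hc
    · exfalso
      obtain ⟨M, hM, -, hc, hc', -⟩ := hrot j hjk
      set a := (j : ℝ) * α with ha
      set b := ((j : ℝ) + 1) * α with hb
      have hba : b - a = α := by rw [hb, ha]; ring
      have hk2 : (2 : ℝ) ≤ k := by exact_mod_cast hk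
      have hαpi : α < Real.pi := by nlinarith
      have hs : 0 < Real.sin (b - a) := by
        rw [hba]; exact Real.sin_pos_of_pos_of_lt_pi hα0 hαpi
      have hs1 : 0 < Real.sin (b - φ) :=
        Real.sin_pos_of_pos_of_lt_pi (by linarith) (by linarith)
      have hs2 : 0 < Real.sin (φ - a) :=
        Real.sin_pos_of_pos_of_lt_pi (by linarith) (by linarith)
      -- Strictly between the two faces `ν` is a positive combination of `ca` and `cb`, whereas the
      -- outer normals of `M` are `ca` and `-cb`. Hence `ν` takes both signs on `M` and cuts it.
      have e : Real.sin (b - a) • ν =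
          Real.sin (b - φ) • (Real.cos a • p + Real.sin a • q) +
          Real.sin (φ - a) • (Real.cos b • p + Real.sin b • q) := by
        rw [hνe, ← hcos, ← hsin]
        simp only [Real.sin_sub]; module
      set ca := Real.cos a • p + Real.sin a • q with hca
      set cb := Real.cos b • p + Real.sin b • q with hcb
      have hne : ca ≠ -cb := by
        intro e1
        have h1 : mink (-cb) (-cb) = 1 := h.unit M hM _ hc'
        have h2 : mink ca cb = Real.cos (b - a) := by
          simp [hca, hcb, hpp, hqq, hpq, mink_comm q p, Real.cos_sub, mul_comm]
        rw [e1] at h2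
        simp only [mink_neg_left, mink_neg_right, neg_neg] at h1 h2
        rw [h1] at h2
        have := Real.sin_sq_add_cos_sq (b - a)
        nlinarith
      have hmem : ∀ f ∈ future, ∀ n ∈ M, mink n f = 0 → (∀ m ∈ M, m ≠ n → mink m f < 0) →
          f ∈ tileCone M := fun f hf n hn h0 h1 => ⟨hf, fun l hl => by
        by_cases e : l = n
        · rw [e, h0]
        · exact (h1 l hl e).le⟩
      obtain ⟨f, hf, hf0, hfM⟩ := h.facet M hM _ hc
      obtain ⟨g, hg, hg0, hgM⟩ := h.facet M hM _ hc'
      have hfM1 := hmem f hf _ hc hf0 hfM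
      have hgM1 := hmem g hg _ hc' hg0 hgM
      have h1 := hfM _ hc' hne.symm
      have h2 := hgM _ hc hne
      rw [mink_neg_left] at h1 hg0
      have h3 : Real.sin (b - a) * mink ν f = Real.sin (φ - a) * mink cb f := by
        rw [← mink_smul_left, e]; simp [hf0]
      have h4 : Real.sin (b - a) * mink ν g = Real.sin (b - φ) * mink ca g := by
        rw [← mink_smul_left, e]; simp [neg_eq_zero.1 hg0]
      have h5 : 0 < mink ν f := pos_of_mul_pos_right (h3 ▸ mul_pos hs2 (by linarith)) hs.le
      have h6 : mink ν g < 0 :=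
        (pos_iff_neg_of_mul_neg (h4 ▸ mul_neg_of_pos_of_neg hs1 h2)).1 hs
      rcases h.tileCone_side hν hM with h7 | h7
      · exact absurd (h7 f hfM1) (not_le.2 h5)
      · exact absurd (h7 g hgM1) (not_le.2 h6)
  rcases lt_trichotomy B 0 with hB | hB | hB
  · have := key (-μ) (neg_mem_walls hμ) (-A) (-B) (by linarith) (by rw [hAB]; module)
    rw [refl_neg_right] at this
    simpa using neg_mem_walls this
  · rw [hB, zero_smul, add_zero] at hAB
    rcases eq_or_eq_neg_of_smul hpp hμμ hAB with e | e
    · exact absurd e hne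
    · exact absurd e hne'
  · exact key μ hμ A B hB hAB

end IsTileSystem

/-! ### Minimal simplices of walls -/

theorem eq_zero_of_linearIndependent {p : Fin 4 → V} (hp : LinearIndependent ℝ p) {z : V}
    (hz : ∀ i, mink (p i) z = 0) : z = 0 := by
  have hspan := hp.span_eq_top_of_card_eq_finrank (by simp)
  have hz' : z ∈ perp (Set.range p) := mem_perp.2 (by rintro _ ⟨i, rfl⟩; exact hz i)
  refine eq_zero_of_mink_eq_zero fun y => ?_
  rw [mink_comm]
  exact hz' y (by rw [hspan]; trivial)

/-- The vertices of the simplicial cone with outer normals `p i`. -/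
theorem exists_vertices {p : Fin 4 → V} (hp : LinearIndependent ℝ p) :
    ∃ w : Fin 4 → V, (∀ j i, mink (p j) (w i) = if j = i then -1 else 0) ∧
      LinearIndependent ℝ w ∧ (∀ v, v = ∑ i, (-mink (p i) v) • w i) ∧
      ∀ m, m = ∑ i, (-mink m (w i)) • p i := by
  let b := basisOfLinearIndependentOfCardEqFinrank hp (by simp)
  -- The sign puts `w i` on the inner side of the facet `p i` opposite to it.
  let w : Fin 4 → V := fun i => -minkForm.dualBasis minkForm_nondegenerate b i
  have hb : ∀ i, b i = p i := fun i => by simp [b]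
  have hw : ∀ j i, mink (p j) (w i) = if j = i then -1 else 0 := by
    intro j i
    have := LinearMap.BilinForm.apply_dualBasis_left minkForm_nondegenerate b i j
    rw [minkForm_apply, hb, mink_comm] at this
    rw [mink_neg_right, this]
    split_ifs <;> simp
  have hli : LinearIndependent ℝ w := by
    rw [Fintype.linearIndependent_iff]
    intro g hg j
    have := congrArg (mink (p j)) hg
    simpa [mink_sum_right, hw] using this
  refine ⟨w, hw, hli, fun v => ?_, fun m => ?_⟩
  · refine sub_eq_zero.1 (eq_zero_of_linearIndependent hp fun i => ?_)
    simp [mink_sum_right, hw]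
  · refine sub_eq_zero.1 (eq_zero_of_linearIndependent hli fun i => ?_)
    rw [mink_comm]
    simp [mink_sum_left, hw]

/-- The tile with the normals `N` is a simplex. -/
def IsSimplexTile (N : Set V) : Prop :=
  ∃ v : Fin 4 → V, LinearIndependent ℝ v ∧ (∀ i, v i ∈ future) ∧
    ∀ x ∈ future, (x ∈ tileCone N ↔ ∃ c : Fin 4 → ℝ, (∀ i, 0 ≤ c i) ∧ x = ∑ i, c i • v i)

theorem mem_tileCone_refl {n : V} (hn : mink n n = 1) {N : Set V} {v : V} :
    v ∈ tileCone (refl n '' N) ↔ refl n v ∈ tileCone N := by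
  constructor
  · rintro ⟨hv, h⟩
    exact ⟨refl_future hn hv, fun l hl => by
      rw [← mink_refl_left]; exact h _ (Set.mem_image_of_mem _ hl)⟩
  · rintro ⟨hv, h⟩
    refine ⟨by simpa [refl_refl hn] using refl_future hn hv, ?_⟩
    rintro _ ⟨l, hl, rfl⟩
    rw [mink_refl_left]; exact h l hl

/-- The reflection as a linear map. -/
def reflLin (n : V) : V →ₗ[ℝ] V where
  toFun := refl n
  map_add' := refl_add n
  map_smul' := refl_smul n

@[simp] theorem reflLin_apply (n v : V) : reflLin n v = refl n v := rfl

theorem linearIndependent_refl {ι : Type*} {n : V} (hn : mink n n = 1) {v : ι → V}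
    (hv : LinearIndependent ℝ v) : LinearIndependent ℝ fun i => refl n (v i) :=
  hv.map' (reflLin n) (LinearMap.ker_eq_bot.2 fun x y hxy => by
    rw [← refl_refl hn x, ← refl_refl hn y]; exact congrArg (refl n) hxy)

theorem IsSimplexTile.refl {n : V} (hn : mink n n = 1) {N : Set V} (hN : IsSimplexTile N) :
    IsSimplexTile (refl n '' N) := by
  obtain ⟨v, hv, hvf, h⟩ := hN
  refine ⟨fun i => Hyp3.refl n (v i), linearIndependent_refl hn hv,
    fun i => refl_future hn (hvf i), fun x hx => ?_⟩
  rw [mem_tileCone_refl hn, h _ (refl_future hn hx)]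
  refine exists_congr fun c => and_congr_right fun _ => ?_
  have e : ∑ i, c i • Hyp3.refl n (v i) = Hyp3.refl n (∑ i, c i • v i) := by
    simp only [← reflLin_apply, map_sum, map_smul]
  rw [e]
  constructor
  · intro h1; rw [← h1, refl_refl hn]
  · intro h1; rw [h1, refl_refl hn]

namespace IsTileSystem

variable {K : Set V} {𝒯 : Set (Set V)} (h : IsTileSystem K 𝒯)
include h

/-- A simplex of walls inside the body that is minimal is not cut by any wall. -/
theorem exists_isSimplexTile (hKf : ∀ x ∈ K, x ≠ 0 → x ∈ future)
    (hex : ∃ p : Fin 4 → V, (∀ i, p i ∈ walls 𝒯) ∧ LinearIndependent ℝ p ∧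
      ∀ v, (∀ i, mink (p i) v ≤ 0) → v ∈ K) : ∃ N ∈ 𝒯, IsSimplexTile N := by
  let 𝒮 : Set (Fin 4 → V) := {p | (∀ i, p i ∈ walls 𝒯) ∧ LinearIndependent ℝ p ∧
      ∀ v, (∀ i, mink (p i) v ≤ 0) → v ∈ K}
  have h𝒮 : 𝒮.Finite := (Set.Finite.pi' fun _ => h.finite_walls).subset fun p hp => hp.1
  -- There are finitely many walls, hence finitely many such simplices; one is chosen minimal for
  -- inclusion of cones.
  obtain ⟨p, hp, hmin⟩ := h𝒮.exists_minimalFor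
    (fun p : Fin 4 → V => {v : V | ∀ i, mink (p i) v ≤ 0}) 𝒮 hex
  obtain ⟨hpw, hpli, hpK⟩ := hp
  obtain ⟨w, hw, hwli, hv, hm⟩ := exists_vertices hpli
  have hwi : ∀ i, mink (p i) (w i) = -1 := fun i => by simp [hw]
  have hwij : ∀ i j, i ≠ j → mink (p i) (w j) = 0 := fun i j hij => by simp [hw, hij]
  have hwQ : ∀ i j, mink (p j) (w i) ≤ 0 := fun i j => by rw [hw]; split_ifs <;> norm_num
  -- a wall cannot cut off a single vertex
  have claim : ∀ m ∈ walls 𝒯, ∀ i, mink m (w i) < 0 → (∀ j, j ≠ i → 0 ≤ mink m (w j)) →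
      ∀ j, j ≠ i → mink m (w j) = 0 := by
    intro m hmw i hi hj j hji
    -- Replacing the facet `p i` by `m` gives a simplex contained in the old one. By minimality the
    -- two coincide, so `m` is non-positive at the remaining vertices as well.
    let p' := Function.update p i m
    have hp'i : p' i = m := Function.update_self _ _ _
    have hp'j : ∀ j, j ≠ i → p' j = p j := fun j hj => Function.update_of_ne hj _ _
    have hsub : ∀ v, (∀ j, mink (p' j) v ≤ 0) → ∀ j, mink (p j) v ≤ 0 := by
      intro v hv' j
      by_cases hji : j = i
      · subst hji
        have e := congrArg (fun z => mink z v) (hm m)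
        simp only [mink_sum_left, mink_smul_left] at e
        rw [← Finset.add_sum_erase _ _ (Finset.mem_univ j)] at e
        have h1 : 0 ≤ ∑ l ∈ Finset.univ.erase j, -mink m (w l) * mink (p l) v := by
          refine Finset.sum_nonneg fun l hl => ?_
          have hlj := Finset.ne_of_mem_erase hl
          have h2 := hj l hlj
          have h3 := hv' l
          rw [hp'j l hlj] at h3
          nlinarith
        have h4 := hv' j
        rw [hp'i] at h4
        by_contra hcon
        push Not at hcon
        nlinarith [mul_pos (neg_pos.2 hi) hcon]
      · have := hv' j
        rwa [hp'j j hji] at this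
    have hp'S : p' ∈ 𝒮 := by
      refine ⟨fun j => ?_, ?_, fun v hv' => hpK v (hsub v hv')⟩
      · by_cases hji : j = i
        · rw [hji, hp'i]; exact hmw
        · rw [hp'j j hji]; exact hpw j
      · rw [Fintype.linearIndependent_iff]
        intro g hg
        have hpair : ∀ l, g i * mink m (w l) +
            ∑ j ∈ Finset.univ.erase i, g j * mink (p j) (w l) = 0 := by
          intro l
          have := congrArg (fun z => mink z (w l)) hg
          simp only [mink_sum_left, mink_smul_left, mink_zero_left] at this
          rw [← Finset.add_sum_erase _ _ (Finset.mem_univ i), hp'i] at this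
          rw [← this]
          congr 1
          exact Finset.sum_congr rfl fun j hj => by rw [hp'j j (Finset.ne_of_mem_erase hj)]
        have hgi : g i = 0 := by
          have := hpair i
          rw [Finset.sum_eq_zero fun j hj => by
            rw [hwij j i (Finset.ne_of_mem_erase hj), mul_zero], add_zero] at this
          exact (mul_eq_zero.1 this).resolve_right hi.ne
        intro l
        by_cases hli : l = i
        · rw [hli, hgi]
        · have := hpair l
          rw [hgi, zero_mul, zero_add, Finset.sum_eq_single l (fun j _ hjl => by
            rw [hwij j l hjl, mul_zero]) (fun hl => absurd (Finset.mem_erase.2 ⟨hli,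
              Finset.mem_univ _⟩) hl), hwi] at this
          linarith
    have hle := hmin hp'S hsub
    have : mink m (w j) ≤ 0 := by
      have := hle (show w j ∈ {v : V | ∀ i, mink (p i) v ≤ 0} from hwQ j) i
      rwa [hp'i] at this
    exact le_antisymm this (hj j hji)
  -- no wall separates vertices
  let 𝓜 : Set V := {m | m ∈ walls 𝒯 ∧ (∃ i, mink m (w i) < 0) ∧ ∃ j, 0 < mink m (w j)}
  have hneg : ∀ m ∈ 𝓜, -m ∈ 𝓜 := by
    rintro m ⟨h1, ⟨i, hi⟩, j, hj⟩
    exact ⟨neg_mem_walls h1, ⟨j, by simpa using hj⟩, i, by simpa using hi⟩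
  have hempty : 𝓜 = ∅ := by
    by_contra hne
    -- This choice of `m` makes reflections in the facets unable to bring it closer to the vertices.
    obtain ⟨m, hmM, hmmin⟩ := Set.exists_min_image 𝓜 (fun m => ∑ i, |mink m (w i)|)
      (h.finite_walls.subset fun m hm => hm.1) (Set.nonempty_iff_ne_empty.2 hne)
    have key : ∀ m ∈ 𝓜, (∀ m' ∈ 𝓜, ∑ i, |mink m (w i)| ≤ ∑ i, |mink m' (w i)|) →
        ∀ i, mink m (w i) < 0 → mink m (p i) ≤ 0 := by
      rintro m ⟨hmw, -, j, hj⟩ hmmin i hi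
      by_contra hpos
      push Not at hpos
      have hij : i ≠ j := by rintro rfl; exact lt_asymm hi hj
      -- By `claim`, applied to `m` and `-m`, each sign occurs at two vertices at least; so `i, k`
      -- are negative and `j, l` positive.
      obtain ⟨k, hki, hk⟩ : ∃ k, k ≠ i ∧ mink m (w k) < 0 := by
        by_contra hcon
        push Not at hcon
        exact hj.ne' (claim m hmw i hi hcon j hij.symm)
      obtain ⟨l, hlj, hl⟩ : ∃ l, l ≠ j ∧ 0 < mink m (w l) := by
        by_contra hcon
        push Not at hcon
        have := claim (-m) (neg_mem_walls hmw) j (by simpa using hj)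
          (fun r hr => by simpa using hcon r hr) i hij
        rw [mink_neg_left, neg_eq_zero] at this
        exact hi.ne this
      have hkj : k ≠ j := by rintro rfl; exact lt_asymm hk hj
      have hkl : k ≠ l := by rintro rfl; exact lt_asymm hk hl
      have hil : i ≠ l := by rintro rfl; exact lt_asymm hi hl
      have hall : ∀ r, r = i ∨ r = j ∨ r = k ∨ r = l := by
        intro r
        revert hij hki hlj hkj hkl hil
        clear * -
        revert i j k l r
        decide
      -- The weight `a` makes `m` vanish at `x`, an inner point of the facet `p i`. There the body
      -- contains the inner side of `p i`, as `refl_mem_walls` requires.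
      let a := (mink m (w j) + mink m (w l)) / -mink m (w k)
      have ha : 0 < a := div_pos (add_pos hj hl) (neg_pos.2 hk)
      let x := a • w k + w j + w l
      have hpx : ∀ r, mink (p r) x = a * mink (p r) (w k) + mink (p r) (w j) + mink (p r) (w l) :=
        fun r => by simp [x]
      have hpi : mink (p i) x = 0 := by
        rw [hpx, hwij i k hki.symm, hwij i j hij, hwij i l hil]; ring
      have hpr : ∀ r, r ≠ i → mink (p r) x < 0 := by
        intro r hr
        rw [hpx]
        rcases hall r with rfl | rfl | rfl | rfl
        · exact absurd rfl hr
        · rw [hwi, hwij _ _ hkj.symm, hwij _ _ hlj.symm]; linarith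
        · rw [hwi, hwij _ _ hkj, hwij _ _ hkl]; linarith
        · rw [hwi, hwij _ _ hkl.symm, hwij _ _ hlj]; linarith
      have hmx : mink m x = 0 := by
        have : a * mink m (w k) = -(mink m (w j) + mink m (w l)) := by
          simp only [a]; field_simp [hk.ne]
        simp only [x, mink_add_right, mink_smul_right, this]; ring
      have hxf : x ∈ future := by
        refine hKf x (hpK x fun r => ?_) ?_
        · by_cases hr : r = i
          · rw [hr, hpi]
          · exact (hpr r hr).le
        · intro e
          have := hpr k hki
          rw [e, mink_zero_right] at this
          exact lt_irrefl _ this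
      have hKx : ∀ᶠ z in 𝓝 x, mink (p i) z ≤ 0 → z ∈ K := by
        have : ∀ᶠ z in 𝓝 x, ∀ r, r ≠ i → mink (p r) z < 0 := by
          rw [eventually_all]
          intro r
          by_cases hr : r = i
          · exact Eventually.of_forall fun _ h' => absurd hr h'
          · have ho : IsOpen {z : V | mink (p r) z < 0} := isOpen_lt (by fun_prop) continuous_const
            filter_upwards [ho.mem_nhds (hpr r hr)] with z hz _ using hz
        filter_upwards [this] with z hz hzi
        refine hpK z fun r => ?_
        by_cases hr : r = i
        · rw [hr]; exact hzi
        · exact (hz r hr).le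
      have hmne : m ≠ p i := fun e => by
        rw [e, hwij i k hki.symm] at hk; exact lt_irrefl _ hk
      have hmne' : m ≠ -p i := fun e => by
        rw [e, mink_neg_left, hwij i k hki.symm, neg_zero] at hk; exact lt_irrefl _ hk
      have hrefl := h.refl_mem_walls (hpw i) hmw hmne hmne' hxf hpi hmx hKx
      have hs : ∀ r, r ≠ i → mink (refl (p i) m) (w r) = mink m (w r) := fun r hr => by
        simp [refl, hwij i r hr.symm]
      have hsi : mink (refl (p i) m) (w i) = mink m (w i) + 2 * mink m (p i) := by
        simp [refl, hwi, mink_comm (p i) m]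
      have h1 := hmmin _ ⟨hrefl, ⟨k, by rwa [hs k hki]⟩, j, by rwa [hs j hij.symm]⟩
      have hsum : ∑ r ∈ Finset.univ.erase i, |mink (refl (p i) m) (w r)| =
          ∑ r ∈ Finset.univ.erase i, |mink m (w r)| :=
        Finset.sum_congr rfl fun r hr => by rw [hs r (Finset.ne_of_mem_erase hr)]
      rw [← Finset.add_sum_erase _ _ (Finset.mem_univ i),
        ← Finset.add_sum_erase Finset.univ (fun r => |mink (refl (p i) m) (w r)|)
          (Finset.mem_univ i), hsum, add_le_add_iff_right, hsi, abs_of_neg hi] at h1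
      -- The reflection changes `m` only at `w i`, where it adds `2 * mink m (p i) > 0`. Without a
      -- change of sign the absolute value would drop, against the choice of `m`. With a positive
      -- value the image cuts off `w k` alone, against `claim`.
      have h2 : 0 < mink m (w i) + 2 * mink m (p i) := by
        by_contra hcon
        push Not at hcon
        rw [abs_of_nonpos hcon] at h1
        linarith
      have h3 := claim _ hrefl k (by rwa [hs k hki]) (fun r hr => by
        rcases hall r with rfl | rfl | rfl | rfl
        · rw [hsi]; exact h2.le
        · rw [hs _ hij.symm]; exact hj.le
        · exact absurd rfl hr
        · rw [hs _ hil.symm]; exact hl.le) j hkj.symm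
      rw [hs j hij.symm] at h3
      exact hj.ne' h3
    have hmm := h.unit_of_wall hmM.1
    -- Expand `mink m m = 1` along the facet normals: `key` for `m` and for `-m` makes every term
    -- non-positive.
    have e := congrArg (mink m) (hm m)
    rw [mink_sum_right, hmm] at e
    have : ∑ i, mink m ((-mink m (w i)) • p i) ≤ 0 := by
      refine Finset.sum_nonpos fun i _ => ?_
      rw [mink_smul_right]
      rcases lt_trichotomy (mink m (w i)) 0 with hi | hi | hi
      · have := key m hmM hmmin i hi
        nlinarith
      · simp [hi]
      · have := key (-m) (hneg m hmM) (fun m' hm' => by simpa using hmmin m' hm') i (by simpa)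
        rw [mink_neg_left] at this
        nlinarith
    linarith
  have hside : ∀ m ∈ walls 𝒯, (∀ i, mink m (w i) ≤ 0) ∨ ∀ i, 0 ≤ mink m (w i) := by
    intro m hmw
    by_contra hcon
    push Not at hcon
    have : m ∈ 𝓜 := ⟨hmw, hcon.2, hcon.1⟩
    rw [hempty] at this
    exact this
  -- the simplex is a tile
  let c := ∑ i, w i
  have hpc : ∀ i, mink (p i) c = -1 := fun i => by simp [c, mink_sum_right, hw]
  have hcK : c ∈ K := hpK c fun i => by rw [hpc]; norm_num
  have hcf : c ∈ future := hKf c hcK fun e => by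
    have := hpc 0
    rw [e] at this; simp at this
  obtain ⟨N, hN, hcN⟩ := (h.cover c hcf).1 hcK
  obtain ⟨c', hc', hc'N⟩ := h.inner N hN
  -- A point interior both to the simplex and to `N`. It decides the sides: `N` lies inside every
  -- facet plane, and the simplex inside every face plane of `N`.
  obtain ⟨ε, ⟨hε, hεp⟩⟩ := ((eventually_interior_tileCone (h.finite_normals N hN) hcN
    fun l hl _ => hc'N l hl).and (eventually_all.2 fun i =>
      eventually_mink_neg (n := p i) (x := c) (by rw [hpc]; norm_num) c')).exists
  generalize c + ε • c' = y at hε hεp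
  have hyN : y ∈ tileCone N := ⟨hε.1, fun l hl => (hε.2 l hl).le⟩
  refine ⟨N, hN, w, hwli, fun i => hKf _ (hpK _ (hwQ i)) (hwli.ne_zero i), fun x hx => ?_⟩
  constructor
  · intro hxN
    refine ⟨_, fun i => ?_, hv x⟩
    have := (h.tileCone_side (hpw i) hN).resolve_right fun hcon =>
      absurd (hcon y hyN) (not_le.2 (hεp i))
    linarith [this x hxN]
  · rintro ⟨g, hg, rfl⟩
    refine ⟨hx, fun l hl => ?_⟩
    have hlw : ∀ i, mink l (w i) ≤ 0 := by
      refine (hside l (mem_walls hN hl)).resolve_right fun hcon => ?_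
      have h1 := hε.2 l hl
      rw [hv y, mink_sum_right] at h1
      refine absurd h1 (not_lt.2 (Finset.sum_nonneg fun i _ => ?_))
      rw [mink_smul_right]
      exact mul_nonneg (by linarith [hεp i]) (hcon i)
    rw [mink_sum_right]
    refine Finset.sum_nonpos fun i _ => ?_
    rw [mink_smul_right]
    exact mul_nonpos_of_nonneg_of_nonpos (hg i) (hlw i)

/-! ### Passing from tile to tile by reflections -/

/-- A property of tiles that is preserved by the reflections holds for all tiles if it holds for
one of them. -/
theorem forall_of_refl {Q : Set V → Prop}
    (hQ : ∀ N ∈ 𝒯, ∀ n ∈ N, refl n '' N ∈ 𝒯 → Q N → Q (refl n '' N)) {N G : Set V} (hN : N ∈ 𝒯)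
    (hG : G ∈ 𝒯) (hQN : Q N) : Q G := by
  -- Induction on the number of walls between `N` and `G`: the ray from inside `N` towards `G`
  -- leaves through a face `l`, and reflecting in `l` removes `l` from this set and adds nothing.
  let sep : Set V → Set V := fun N => {m | m ∈ walls 𝒯 ∧ (∀ v ∈ tileCone N, mink m v ≤ 0) ∧
    ∀ v ∈ tileCone G, 0 ≤ mink m v}
  have hsep : ∀ N, (sep N).Finite := fun N => h.finite_walls.subset fun m hm => hm.1
  obtain ⟨r, hr⟩ : ∃ r, (sep N).ncard = r := ⟨_, rfl⟩
  induction r using Nat.strong_induction_on generalizing N with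
  | _ r ih =>
  obtain ⟨c, hc, hcN⟩ := h.inner N hN
  obtain ⟨d, hd, hdG⟩ := h.inner G hG
  have hdG' : d ∈ tileCone G := ⟨hd, fun l hl => (hdG l hl).le⟩
  by_cases hex : ∃ l ∈ N, 0 < mink l d
  · obtain ⟨t, ht, hxN, l, hl, hld, hlx⟩ := exists_exit (h.finite_normals N hN) hc hd
      (fun l hl _ => hcN l hl) (fun l hl => (hcN l hl).le) hex
    have hll := h.unit N hN l hl
    have hN1 := h.neighbor N hN l hl _ hxN hlx
      (h.smul_mem_of_mem_tileCone hG (h.mem_nhds_of_interior hN hc hcN) hdG' ht.le)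
    have hrc : refl l c ∈ tileCone (refl l '' N) := by
      rw [mem_tileCone_refl hll, refl_refl hll]
      exact ⟨hc, fun n hn => (hcN n hn).le⟩
    have hlrc : 0 < mink l (refl l c) := by
      rw [← mink_refl_left, refl_self hll, mink_neg_left]; linarith [hcN l hl]
    have hlt : (sep (refl l '' N)).ncard < r := by
      rw [← hr]
      refine Set.ncard_lt_ncard ⟨?_, fun hsub => ?_⟩ (hsep N)
      · rintro m ⟨hm, hm1, hmG⟩
        refine ⟨hm, (h.tileCone_side hm hN).resolve_right fun hm2 => ?_, hmG⟩
        obtain ⟨f, hf, hlf, hfN⟩ := h.facet N hN l hl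
        have hfN' : f ∈ tileCone N := ⟨hf, fun n hn => by
          by_cases e : n = l
          · rw [e, hlf]
          · exact (hfN n hn e).le⟩
        -- A newly separating wall would have `N` and its mirror image on different sides. It would
        -- vanish on their common face and therefore be `l` or `-l`.
        have hzero : ∀ v, mink l v = 0 → v ∈ tileCone N → mink m v = 0 := fun v hlv hvN =>
          le_antisymm (hm1 v ((mem_tileCone_refl hll).2 (by rwa [refl_of_mink_eq_zero hlv])))
            (hm2 v hvN)
        obtain ⟨a, ha⟩ := exists_smul_of_perp_le (n := l) (m := m) fun v hlv => by
          obtain ⟨ε, hε, hε0⟩ := ((eventually_mem_tileCone (h.finite_normals N hN) (y := v) hfN'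
            fun n hn hnf => by
              by_cases e : n = l
              · rw [e, hlv]
              · exact absurd hnf (hfN n hn e).ne).and eventually_pos_right).exists
          have h1 := hzero _ (by simp [hlf, hlv]) hε
          rw [mink_add_right, hzero f hlf hfN', mink_smul_right, zero_add] at h1
          exact (mul_eq_zero.1 h1).resolve_left hε0.ne'
        rcases eq_or_eq_neg_of_smul hll (h.unit_of_wall hm) ha with rfl | rfl
        · exact absurd (hm1 _ hrc) (not_le.2 hlrc)
        · have := hmG d hdG'
          rw [mink_neg_left] at this
          linarith
      · have hlN : l ∈ sep N := ⟨mem_walls hN hl, fun v hv => hv.2 l hl,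
          (h.tileCone_side (mem_walls hN hl) hG).resolve_left fun hcon =>
            absurd (hcon d hdG') (not_le.2 hld)⟩
        exact absurd ((hsub hlN).2.1 _ hrc) (not_le.2 hlrc)
    exact ih _ hlt hN1 (hQ N hN l hl hN1 hQN) rfl
  -- If no face of `N` separates it from the interior point `d` of `G`, then `d` lies in `N`, and
  -- the interiors of `N` and `G` meet.
  · push Not at hex
    obtain ⟨ε, h1, h2⟩ := ((eventually_interior_tileCone (h.finite_normals N hN) (y := c)
      ⟨hd, hex⟩ fun n hn _ => hcN n hn).and (eventually_interior_tileCone (h.finite_normals G hG)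
      (y := c) hdG' fun n hn h0 => absurd h0 (hdG n hn).ne)).exists
    rw [← h.disjoint N hN G hG _ h1.1 h1.2 h2.2]
    exact hQN

/-! ### The simplex at the apex -/

/-- The normals of a tile that are orthogonal to a time-like vector are linearly independent. -/
theorem linearIndependent_active {N : Set V} (hN : N ∈ 𝒯) {O : V} (hO : O ∈ future) :
    LinearIndependent ℝ ((↑) : {n | n ∈ N ∧ mink n O = 0} → V) := by
  have hfin : {n | n ∈ N ∧ mink n O = 0}.Finite :=
    (h.finite_normals N hN).subset fun n hn => hn.1
  have := hfin.fintype
  rw [Fintype.linearIndependent_iff]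
  intro g hg
  obtain ⟨c, hc, hcN⟩ := h.inner N hN
  -- A linear relation is split into its positive and negative parts, `x = y`. They have disjoint
  -- supports, so `mink x y ≤ 0` by acute-angledness, while the form is positive definite on vectors
  -- orthogonal to `O`. Hence both vanish, and pairing with the inner point `c` kills all
  -- coefficients.
  let x : V := ∑ i : {n | n ∈ N ∧ mink n O = 0}, max (g i) 0 • (i : V)
  let y : V := ∑ i : {n | n ∈ N ∧ mink n O = 0}, max (-g i) 0 • (i : V)
  have hxy : x = y := by
    rw [← sub_eq_zero, ← hg, ← Finset.sum_sub_distrib]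
    refine Finset.sum_congr rfl fun i _ => ?_
    rw [← sub_smul]
    congr 1
    rcases le_total (g i) 0 with hi | hi
    · rw [max_eq_right hi, max_eq_left (by linarith)]; ring
    · rw [max_eq_left hi, max_eq_right (by linarith)]; ring
  have hxx : mink x x ≤ 0 := by
    conv_lhs => rw [show mink x x = mink x y by rw [← hxy]]
    rw [mink_sum_left]
    refine Finset.sum_nonpos fun i _ => ?_
    rw [mink_sum_right]
    refine Finset.sum_nonpos fun j _ => ?_
    rw [mink_smul_left, mink_smul_right]
    by_cases hij : i = j
    · subst hij
      rcases le_total (g i) 0 with hi | hi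
      · rw [max_eq_right hi, zero_mul]
      · rw [max_eq_right (show -g i ≤ 0 by linarith), zero_mul, mul_zero]
    · have := h.mink_nonpos hN i.2.1 j.2.1 fun e => hij (Subtype.ext e)
      exact mul_nonpos_of_nonneg_of_nonpos (le_max_right _ _)
        (mul_nonpos_of_nonneg_of_nonpos (le_max_right _ _) this)
  have hx0 : x = 0 := by
    by_contra hne
    refine absurd hxx (not_le.2 (mink_self_pos hO ?_ hne))
    rw [mink_sum_right]
    refine Finset.sum_eq_zero fun i _ => ?_
    rw [mink_smul_right, mink_comm, i.2.2, mul_zero]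
  have hzero : ∀ f : {n | n ∈ N ∧ mink n O = 0} → ℝ, (∀ i, 0 ≤ f i) →
      ∑ i, f i • (i : V) = 0 → ∀ i, f i = 0 := by
    intro f hf hsum i
    have h1 := congrArg (fun z => mink z c) hsum
    simp only [mink_sum_left, mink_smul_left, mink_zero_left] at h1
    rw [Finset.sum_eq_zero_iff_of_nonpos fun i _ =>
      mul_nonpos_of_nonneg_of_nonpos (hf i) (hcN i i.2.1).le] at h1
    exact (mul_eq_zero.1 (h1 i (Finset.mem_univ _))).resolve_right (hcN i i.2.1).ne
  intro i
  have h1 := hzero _ (fun i => le_max_right (g i) 0) hx0 i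
  have h2 := hzero _ (fun i => le_max_right (-g i) 0) (hxy.symm.trans hx0) i
  have h3 := le_max_left (g i) 0
  have h4 := le_max_left (-g i) 0
  linarith

/-- At the apex of a pyramid, the planes of the faces of a tile and the base bound a simplex. -/
theorem exists_simplex_of_apex {O b : V} {B : Set V} (hO : O ∈ future) (hb : b ∈ walls 𝒯)
    (hbO : mink b O < 0) (hK : ∀ v, v ∈ K ↔ ∃ s : ℝ, 0 ≤ s ∧ ∃ a ∈ B, v = s • O + a)
    (hBb : ∀ a ∈ B, mink b a = 0) (hB0 : (0 : V) ∈ B)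
    (hBs : ∀ a ∈ B, ∀ c : ℝ, 0 ≤ c → c • a ∈ B)
    (hBp : ∀ a ∈ B, ∀ a' ∈ B, a + a' = 0 → a = 0) :
    ∃ p : Fin 4 → V, (∀ i, p i ∈ walls 𝒯) ∧ LinearIndependent ℝ p ∧
      ∀ v, (∀ i, mink (p i) v ≤ 0) → v ∈ K := by
  obtain ⟨N, hN, hON⟩ := (h.cover O hO).1 ((hK O).2 ⟨1, zero_le_one, 0, hB0, by simp⟩)
  have hNf := h.finite_normals N hN
  let A : Set V := {n | n ∈ N ∧ mink n O = 0}
  have hA : A.Finite := hNf.subset fun n hn => hn.1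
  have hAli : LinearIndependent ℝ ((↑) : A → V) := h.linearIndependent_active hN hO
  have := hA.fintype
  -- For `d` orthogonal to all active normals, `O + ε • d` and `O - ε • d` are both in `K`. They add
  -- up to `2 • O`, so their components in the base cancel, and that cone contains no pair of
  -- opposite nonzero vectors. Thus `d` is a multiple of `O`.
  have hperp : perp A ≤ Submodule.span ℝ {O} := by
    intro d hd
    rw [mem_perp] at hd
    obtain ⟨ε, ⟨h1, h2⟩, hε⟩ := (((eventually_mem_tileCone hNf (y := d) hON
      fun l hl hlO => (hd l ⟨hl, hlO⟩).le).and (eventually_mem_tileCone hNf (y := -d) hON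
      fun l hl hlO => by rw [mink_neg_right, hd l ⟨hl, hlO⟩, neg_zero])).and
      eventually_pos_right).exists
    obtain ⟨s, -, a, ha, e⟩ := (hK _).1 (h.mem_of_mem_tileCone hN h1)
    obtain ⟨s', -, a', ha', e'⟩ := (hK _).1 (h.mem_of_mem_tileCone hN h2)
    have hs : s + s' = 2 := by
      have h3 : mink b ((O + ε • d) + (O + ε • -d)) = mink b (s • O + a + (s' • O + a')) := by
        rw [e, e']
      simp only [mink_add_right, mink_smul_right, mink_neg_right, hBb a ha, hBb a' ha'] at h3
      have h4 : (s + s' - 2) * mink b O = 0 := by linarith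
      have := (mul_eq_zero.1 h4).resolve_right hbO.ne
      linarith
    have ha0 : a = 0 := by
      refine hBp a ha a' ha' ?_
      have h3 : (O + ε • d) + (O + ε • -d) = (s + s') • O + (a + a') := by
        rw [e, e']; module
      rw [hs] at h3
      have h5 : a + a' = (O + ε • d) + (O + ε • -d) - (2 : ℝ) • O := by rw [h3]; module
      rw [h5]; module
    rw [Submodule.mem_span_singleton]
    refine ⟨ε⁻¹ * (s - 1), ?_⟩
    have h3 : ε • d = (s - 1) • O := by
      have : ε • d = (O + ε • d) - O := by module
      rw [this, e, ha0]; module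
    rw [mul_smul, ← h3, smul_smul, inv_mul_cancel₀ hε.ne', one_smul]
  have hcard : Fintype.card A = 3 := by
    have h1 : Module.finrank ℝ (Submodule.span ℝ A) = Fintype.card A := by
      have := finrank_span_eq_card hAli
      rwa [Subtype.range_coe] at this
    have h2 := Submodule.finrank_mono hperp
    rw [finrank_perp, finrank_span_singleton (ne_zero_of_future hO), h1] at h2
    have h3 : Submodule.span ℝ A ≤ perp {O} := by
      rw [Submodule.span_le]
      intro n hn
      rw [SetLike.mem_coe, mem_perp]
      rintro _ rfl
      rw [mink_comm]; exact hn.2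
    have h4 := Submodule.finrank_mono h3
    rw [h1, finrank_perp_singleton (ne_zero_of_future hO)] at h4
    omega
  let e : Fin 3 ≃ A := (Fintype.equivFinOfCardEq hcard).symm
  refine ⟨Fin.cons b fun i => (e i : V), fun i => ?_, ?_, fun v hv => ?_⟩
  · refine Fin.cases ?_ (fun i => ?_) i
    · exact hb
    · exact mem_walls hN (e i).2.1
  · rw [linearIndependent_finCons]
    refine ⟨hAli.comp e e.injective, fun hmem => ?_⟩
    have : Submodule.span ℝ (Set.range fun i => (e i : V)) ≤ perp {O} := by
      rw [Submodule.span_le]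
      rintro _ ⟨i, rfl⟩
      rw [SetLike.mem_coe, mem_perp]
      rintro _ rfl
      rw [mink_comm]; exact (e i).2.2
    have := mem_perp.1 (this hmem) O rfl
    rw [mink_comm] at this
    exact hbO.ne this
  · have hbv : mink b v ≤ 0 := hv 0
    have hev : ∀ i : Fin 3, mink (e i) v ≤ 0 := fun i => hv i.succ
    -- The three normals at the apex ensure that `O + ε • v` stays in the tile; the base inequality
    -- for `v` then says that its coefficient at `O` is at least `1`. Subtracting `O` leaves `ε • v`
    -- in `K`.
    obtain ⟨ε, h1, hε⟩ := ((eventually_mem_tileCone hNf (y := v) hON fun l hl hlO => by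
      have := hev (e.symm ⟨l, hl, hlO⟩)
      rwa [e.apply_symm_apply] at this).and eventually_pos_right).exists
    obtain ⟨s, -, a, ha, hs⟩ := (hK _).1 (h.mem_of_mem_tileCone hN h1)
    have h2 : ε * mink b v = (s - 1) * mink b O := by
      have := congrArg (mink b) hs
      simp only [mink_add_right, mink_smul_right, hBb a ha] at this
      linarith
    have h3 : 0 ≤ s - 1 := by
      by_contra hcon
      push Not at hcon
      have := mul_pos_of_neg_of_neg hcon hbO
      nlinarith
    refine (hK v).2 ⟨ε⁻¹ * (s - 1), mul_nonneg (inv_pos.2 hε).le h3, ε⁻¹ • a,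
      hBs a ha _ (inv_pos.2 hε).le, ?_⟩
    have h4 : ε • v = (s - 1) • O + a := by
      have : ε • v = (O + ε • v) - O := by module
      rw [this, hs]; module
    rw [mul_smul, ← smul_add, ← h4, smul_smul, inv_mul_cancel₀ hε.ne', one_smul]

end IsTileSystem

/-! ### Polyhedra and their cones -/

theorem coe_mem_future (x : Space) : (x : V) ∈ future :=
  ⟨by rw [x.2.1]; norm_num, x.2.2⟩

theorem exists_eq_smul_coe {v : V} (hv : v ∈ future) :
    ∃ x : Space, v = √(-mink v v) • (x : V) := by
  have h1 : 0 < -mink v v := neg_pos.2 hv.1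
  have h2 : 0 < √(-mink v v) := Real.sqrt_pos.2 h1
  refine ⟨⟨(√(-mink v v))⁻¹ • v, ?_, mul_pos (inv_pos.2 h2) hv.2⟩, ?_⟩
  · rw [mink_smul_left, mink_smul_right, ← mul_assoc, ← mul_inv, Real.mul_self_sqrt h1.le]
    have := hv.1.ne
    field_simp
  · rw [smul_smul, mul_inv_cancel₀ h2.ne', one_smul]

theorem exists_pos_smul_coe {v : V} (hv : v ∈ future) :
    ∃ c : ℝ, 0 < c ∧ ∃ x : Space, v = c • (x : V) :=
  ⟨_, Real.sqrt_pos.2 (neg_pos.2 hv.1), exists_eq_smul_coe hv⟩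

theorem smul_coe_injective {c d : ℝ} (hc : 0 < c) (hd : 0 < d) {x y : Space}
    (h : c • (x : V) = d • (y : V)) : x = y := by
  have h1 := congrArg (fun v => mink v v) h
  simp only [mink_smul_left, mink_smul_right, x.2.1, y.2.1] at h1
  have h2 : c = d := by nlinarith
  subst h2
  exact Subtype.ext (smul_right_injective V hc.ne' h)

/-- The cone over a subset of the hyperboloid. -/
def coneOf (X : Set Space) : Set V := {v | ∃ c : ℝ, 0 < c ∧ ∃ y ∈ X, v = c • (y : V)}

theorem smul_coe_mem_coneOf {X : Set Space} {c : ℝ} (hc : 0 < c) {x : Space} :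
    c • (x : V) ∈ coneOf X ↔ x ∈ X := by
  constructor
  · rintro ⟨d, hd, y, hy, e⟩
    rwa [smul_coe_injective hc hd e]
  · exact fun hx => ⟨c, hc, x, hx, rfl⟩

theorem coe_mem_coneOf {X : Set Space} {x : Space} : (x : V) ∈ coneOf X ↔ x ∈ X := by
  simpa using smul_coe_mem_coneOf (X := X) one_pos (x := x)

/-- The radial projection of `future` to the hyperboloid is continuous, so interiors in the
hyperbolic space can be tested on cones in `V`. -/
theorem coneOf_mem_nhds {X : Set Space} {x : Space} : coneOf X ∈ 𝓝 (x : V) ↔ X ∈ 𝓝 x := by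
  constructor
  · intro h
    have h' : ∀ᶠ y : Space in 𝓝 x, (y : V) ∈ coneOf X :=
      (continuous_subtype_val (p := fun x : V => mink x x = -1 ∧ 0 < x 0)).tendsto x h
    filter_upwards [h'] with y hy
    exact coe_mem_coneOf.1 hy
  · intro h
    rw [nhds_subtype_eq_comap, mem_comap] at h
    obtain ⟨U, hU, hUX⟩ := h
    have hcont : ContinuousAt (fun v : V => (√(-mink v v))⁻¹ • v) (x : V) := by
      have h1 : Continuous fun v : V => √(-mink v v) := by fun_prop
      have h2 : √(-mink (x : V) x) ≠ 0 := by simp [x.2.1]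
      exact (h1.continuousAt.inv₀ h2).smul continuousAt_id
    have hx : (√(-mink (x : V) x))⁻¹ • (x : V) = x := by simp [x.2.1]
    have hU' : U ∈ 𝓝 ((√(-mink (x : V) x))⁻¹ • (x : V)) := by rwa [hx]
    filter_upwards [hcont hU', isOpen_future.mem_nhds (coe_mem_future x)] with v hv hvf
    obtain ⟨y, hy⟩ := exists_eq_smul_coe hvf
    have hpos := Real.sqrt_pos.2 (neg_pos.2 hvf.1)
    refine ⟨_, hpos, y, hUX ?_, hy⟩
    change (y : V) ∈ U
    have : (√(-mink v v))⁻¹ • v = y := by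
      conv_lhs => rw [hy, smul_smul]
      rw [← hy, inv_mul_cancel₀ hpos.ne', one_smul]
    rw [← this]
    exact hv

/-- The linear span of a subset of the hyperboloid. -/
def linSpan (X : Set Space) : Submodule ℝ V :=
  Submodule.span ℝ ((fun x : Space => (x : V)) '' X)

theorem spanRank_eq (X : Set Space) : spanRank X = Module.finrank ℝ (linSpan X) := rfl

theorem coe_mem_linSpan {X : Set Space} {x : Space} (hx : x ∈ X) : (x : V) ∈ linSpan X :=
  Submodule.subset_span ⟨x, hx, rfl⟩

theorem linSpan_le {X : Set Space} {S : Submodule ℝ V} : linSpan X ≤ S ↔ ∀ x ∈ X, (x : V) ∈ S := by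
  rw [linSpan, Submodule.span_le, Set.image_subset_iff]; rfl

theorem linSpan_le_perp {X : Set Space} {n : V} :
    linSpan X ≤ perp {n} ↔ ∀ x ∈ X, mink n x = 0 := by
  rw [linSpan_le]
  simp only [mem_perp, Set.mem_singleton_iff, forall_eq]

theorem perp_le_perp {n m : V} (hn : mink n n = 1) (hm : mink m m = 1)
    (h : perp {n} ≤ perp {m}) : m = n ∨ m = -n := by
  obtain ⟨c, hc⟩ := exists_smul_of_perp_le (n := n) (m := m) fun v hv =>
    mem_perp.1 (h (mem_perp.2 fun k hk => by rw [Set.mem_singleton_iff.1 hk]; exact hv)) m rfl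
  exact eq_or_eq_neg_of_smul hn hm hc

/-- The subset of the hyperboloid cut out by a set of outer normals. -/
def cut (N : Set V) : Set Space := {x | ∀ n ∈ N, mink n x ≤ 0}

theorem coe_mem_tileCone {N : Set V} {x : Space} : (x : V) ∈ tileCone N ↔ x ∈ cut N :=
  ⟨fun h => h.2, fun h => ⟨coe_mem_future x, h⟩⟩

theorem smul_coe_mem_tileCone {N : Set V} {x : Space} {c : ℝ} (hc : 0 < c) :
    c • (x : V) ∈ tileCone N ↔ x ∈ cut N := by
  rw [← coe_mem_tileCone]
  refine ⟨fun h => ?_, fun h => tileCone_smul h hc⟩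
  have := tileCone_smul h (inv_pos.2 hc)
  rwa [smul_smul, inv_mul_cancel₀ hc.ne', one_smul] at this

theorem coneOf_cut (N : Set V) : coneOf (cut N) = tileCone N := by
  ext v
  constructor
  · rintro ⟨c, hc, y, hy, rfl⟩
    exact (smul_coe_mem_tileCone hc).2 hy
  · intro hv
    obtain ⟨c, hc, y, rfl⟩ := exists_pos_smul_coe hv.1
    exact (smul_coe_mem_coneOf hc).2 ((smul_coe_mem_tileCone hc).1 hv)

theorem mink_smul_neg_iff {n x : V} {c : ℝ} (hc : 0 < c) : mink n (c • x) < 0 ↔ mink n x < 0 := by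
  rw [mink_smul_right]
  exact ⟨fun h => (pos_iff_neg_of_mul_neg h).1 hc, fun h => mul_neg_of_pos_of_neg hc h⟩

theorem mem_interior_cut {N : Set V} (hN : N.Finite) {x : Space} (hx : ∀ n ∈ N, mink n x < 0) :
    x ∈ interior (cut N) := by
  rw [mem_interior_iff_mem_nhds, ← coneOf_mem_nhds, coneOf_cut]
  refine mem_of_superset ((isOpen_interior_tileCone hN).mem_nhds ⟨coe_mem_future x, hx⟩) ?_
  exact fun y hy => ⟨hy.1, fun n hn => (hy.2 n hn).le⟩

theorem mink_neg_of_mem_interior_cut {N : Set V} {x : Space} (hx : x ∈ interior (cut N)) {n : V}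
    (hn : n ∈ N) (hnn : mink n n = 1) : mink n x < 0 := by
  rw [mem_interior_iff_mem_nhds, ← coneOf_mem_nhds, coneOf_cut] at hx
  have hev : ∀ᶠ ε : ℝ in 𝓝[>] 0, (x : V) + ε • n ∈ tileCone N := tendsto_line (x : V) n hx
  obtain ⟨ε, hε, hε0⟩ := (hev.and eventually_pos_right).exists
  have := hε.2 n hn
  rw [mink_add_right, mink_smul_right, hnn, mul_one] at this
  linarith

/-- A finite set of unit normals that defines a polyhedron and has no superfluous elements. -/
structure IsReduced (N : Set V) : Prop where
  finite : N.Finite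
  unit : ∀ n ∈ N, mink n n = 1
  inner : ∃ c ∈ future, ∀ n ∈ N, mink n c < 0
  facet : ∀ n ∈ N, ∃ f ∈ future, mink n f = 0 ∧ ∀ m ∈ N, m ≠ n → mink m f < 0

theorem IsReduced.refl {N : Set V} (h : IsReduced N) {l : V} (hl : mink l l = 1) :
    IsReduced (refl l '' N) where
  finite := h.finite.image _
  unit := by
    rintro _ ⟨n, hn, rfl⟩
    rw [mink_refl_refl hl]; exact h.unit n hn
  inner := by
    obtain ⟨c, hc, hcN⟩ := h.inner
    refine ⟨Hyp3.refl l c, refl_future hl hc, ?_⟩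
    rintro _ ⟨n, hn, rfl⟩
    rw [mink_refl_refl hl]; exact hcN n hn
  facet := by
    rintro _ ⟨n, hn, rfl⟩
    obtain ⟨f, hf, hnf, hfN⟩ := h.facet n hn
    refine ⟨Hyp3.refl l f, refl_future hl hf, by rwa [mink_refl_refl hl], ?_⟩
    rintro _ ⟨m, hm, rfl⟩ hne
    rw [mink_refl_refl hl]
    exact hfN m hm fun e => hne (by rw [e])

/-- Take a minimal subset of the given normals with the same intersection. Dropping `n` admits a
point `z` violating only `n`; the segment from the interior point `c` to `z` meets the plane of `n`
at an inner point of the face. -/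
theorem exists_isReduced {F : Set Space} (hF : IsPolyhedron F) : ∃ N, IsReduced N ∧ F = cut N := by
  obtain ⟨⟨N₀, hN₀, rfl⟩, c, hc⟩ := hF
  let N₁ : Set V := Subtype.val '' N₀
  have hcut : (⋂ n ∈ N₀, halfSpace n) = cut N₁ := by
    ext x
    simp only [Set.mem_iInter]
    constructor
    · rintro h _ ⟨n, hn, rfl⟩; exact h n hn
    · exact fun h n hn => h n ⟨n, hn, rfl⟩
  rw [hcut] at hc ⊢
  have hN₁ : N₁.Finite := hN₀.image _
  have hunit : ∀ n ∈ N₁, mink n n = 1 := by rintro _ ⟨n, -, rfl⟩; exact n.2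
  obtain ⟨N, ⟨hNN, hNc⟩, hmin⟩ := (hN₁.finite_subsets.subset
    (fun N (hN : N ⊆ N₁ ∧ cut N = cut N₁) => hN.1)).exists_minimalFor id
      {N | N ⊆ N₁ ∧ cut N = cut N₁} ⟨N₁, subset_rfl, rfl⟩
  have hcN : ∀ n ∈ N, mink n c < 0 := fun n hn =>
    mink_neg_of_mem_interior_cut hc (hNN hn) (hunit n (hNN hn))
  refine ⟨N, ⟨hN₁.subset hNN, fun n hn => hunit n (hNN hn), ⟨c, coe_mem_future c, hcN⟩,
    fun n hn => ?_⟩, hNc.symm⟩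
  obtain ⟨z, hz, hnz⟩ : ∃ z : Space, (∀ m ∈ N, m ≠ n → mink m z ≤ 0) ∧ 0 < mink n z := by
    by_contra hcon
    push Not at hcon
    have hsub : N \ {n} ⊆ N := Set.sdiff_subset
    have := hmin (j := N \ {n}) ⟨hsub.trans hNN, by
      rw [← hNc]
      refine Set.Subset.antisymm (fun x hx m hm => ?_) fun x hx m hm => hx m hm.1
      by_cases e : m = n
      · rw [e]
        exact hcon x fun m hm hmn => hx m ⟨hm, hmn⟩
      · exact hx m ⟨hm, e⟩⟩ hsub
    exact (this hn).2 rfl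
  have hnc := neg_pos.2 (hcN n hn)
  refine ⟨mink n z • (c : V) + (-mink n c) • (z : V), future_add (future_smul hnz (coe_mem_future c))
    (future_smul hnc (coe_mem_future z)), ?_, fun m hm hmn => ?_⟩
  · simp only [mink_add_right, mink_smul_right]; ring
  · simp only [mink_add_right, mink_smul_right]
    have h1 := mul_neg_of_pos_of_neg hnz (hcN m hm)
    have h2 := mul_nonpos_of_nonneg_of_nonpos hnc.le (hz m hm hmn)
    linarith

/-- Near a point of a tile, the tile fills the intersection of the planes of the faces through
this point. -/
theorem le_linSpan {N : Set V} (hN : N.Finite) {x : V} (hx : x ∈ tileCone N) {D : Submodule ℝ V}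
    (hxD : x ∈ D) (hD : ∀ l ∈ N, mink l x = 0 → ∀ v ∈ D, mink l v = 0) {X : Set Space}
    (hX : ∀ y ∈ cut N, (y : V) ∈ D → y ∈ X) : D ≤ linSpan X := by
  have key : ∀ z ∈ tileCone N, z ∈ D → z ∈ linSpan X := by
    intro z hz hzD
    obtain ⟨c, hc, y, rfl⟩ := exists_pos_smul_coe hz.1
    exact (linSpan X).smul_mem c (coe_mem_linSpan (hX y ((smul_coe_mem_tileCone hc).1 hz)
      ((D.smul_mem_iff hc.ne').1 hzD)))
  intro v hv
  obtain ⟨ε, hε, hε0⟩ := ((eventually_mem_tileCone hN (y := v) hx fun l hl hlx =>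
    (hD l hl hlx v hv).le).and eventually_pos_right).exists
  have h1 := key _ hε (D.add_mem hxD (D.smul_mem ε hv))
  exact ((linSpan X).smul_mem_iff hε0.ne').1
    (((linSpan X).add_mem_iff_right (key x hx hxD)).1 h1)

theorem convex_tileCone (N : Set V) : Convex ℝ (tileCone N) := by
  rw [convex_iff_forall_pos]
  intro x hx y hy a b ha hb _
  refine ⟨future_add (future_smul ha hx.1) (future_smul hb hy.1), fun n hn => ?_⟩
  have h1 := mul_nonpos_of_nonneg_of_nonpos ha.le (hx.2 n hn)
  have h2 := mul_nonpos_of_nonneg_of_nonpos hb.le (hy.2 n hn)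
  simp only [mink_add_right, mink_smul_right]
  linarith

/-- The outer unit normals of the faces of a polyhedron, as vectors. -/
def faceNormals (F : Set Space) : Set V := {n | ∃ hn : mink n n = 1, IsFaceNormal F ⟨n, hn⟩}

theorem IsReduced.perp_le_linSpan {N : Set V} (h : IsReduced N) {n : V} (hn : n ∈ N) :
    perp {n} ≤ linSpan (cut N ∩ {x | mink n x = 0}) := by
  obtain ⟨f, hf, hnf, hfN⟩ := h.facet n hn
  have hf' : f ∈ tileCone N := ⟨hf, fun m hm => by
    by_cases e : m = n
    · rw [e, hnf]
    · exact (hfN m hm e).le⟩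
  refine le_linSpan h.finite hf' (mem_perp.2 (by rintro _ rfl; exact hnf)) (fun l hl hlf v hv => ?_)
    fun y hy hyn => ⟨hy, mem_perp.1 hyn n rfl⟩
  by_cases e : l = n
  · rw [e]; exact mem_perp.1 hv n rfl
  · exact absurd hlf (hfN l hl e).ne

/-- A reduced description is thus unique and intrinsic. A face with a normal outside `N` would span
its plane, hence have a point on no plane of `N`; from there one could move along the normal and
stay in the polyhedron. -/
theorem IsReduced.faceNormals_cut {N : Set V} (h : IsReduced N) : faceNormals (cut N) = N := by
  ext n
  constructor
  · rintro ⟨hnn, hsub, hrank⟩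
    have hle : linSpan (cut N ∩ plane ⟨n, hnn⟩) ≤ perp {n} := linSpan_le_perp.2 fun x hx => hx.2
    have heq : linSpan (cut N ∩ plane ⟨n, hnn⟩) = perp {n} :=
      Submodule.eq_of_le_of_finrank_eq hle
        (by rw [finrank_perp_singleton (ne_zero_of_unit hnn)]; exact hrank)
    have hcut : ∀ z ∈ tileCone N, mink n z ≤ 0 := by
      intro z hz
      obtain ⟨c, hc, y, rfl⟩ := exists_pos_smul_coe hz.1
      have : mink n y ≤ 0 := hsub ((smul_coe_mem_tileCone hc).1 hz)
      rw [mink_smul_right]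
      exact mul_nonpos_of_nonneg_of_nonpos hc.le this
    have hC : Convex ℝ (tileCone N ∩ perp {n}) := (convex_tileCone N).inter (perp {n}).convex
    have hne : (cut N ∩ plane ⟨n, hnn⟩).Nonempty := by
      rw [Set.nonempty_iff_ne_empty]
      intro e
      have h0 : Module.finrank ℝ (linSpan (cut N ∩ plane ⟨n, hnn⟩)) = 3 := hrank
      rw [e, linSpan, Set.image_empty, Submodule.span_empty, finrank_bot] at h0
      omega
    have hmemC : ∀ x ∈ cut N ∩ plane ⟨n, hnn⟩, (x : V) ∈ tileCone N ∩ perp {n} := fun x hx =>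
      ⟨coe_mem_tileCone.2 hx.1, mem_perp.2 (by rintro _ rfl; exact hx.2)⟩
    obtain ⟨x₀, hx₀⟩ := hne
    by_contra hnN
    have hex : ∀ m ∈ N, ∃ x ∈ tileCone N ∩ perp {n}, x ∉ perp {m} := by
      intro m hm
      by_contra hcon
      push Not at hcon
      have : perp {n} ≤ perp {m} := by
        rw [← heq, linSpan_le]
        exact fun x hx => hcon x (hmemC x hx)
      rcases perp_le_perp hnn (h.unit m hm) this with e | e
      · exact hnN (e ▸ hm)
      · obtain ⟨c, hc, hcN⟩ := h.inner
        have h1 := hcut c ⟨hc, fun l hl => (hcN l hl).le⟩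
        have h2 := hcN m hm
        rw [e, mink_neg_left] at h2
        linarith
    obtain ⟨x, ⟨hx, hxn⟩, hxN⟩ := exists_mem_forall_notMem_submodule hC h.finite (fun m => perp {m})
      ⟨x₀, hmemC x₀ hx₀⟩ hex
    obtain ⟨ε, hε, hε0⟩ := ((eventually_mem_tileCone h.finite (y := n) hx fun l hl hlx =>
      absurd (mem_perp.2 (by rintro _ rfl; exact hlx)) (hxN l hl)).and eventually_pos_right).exists
    have h1 := hcut _ hε
    rw [mink_add_right, mink_smul_right, hnn, mem_perp.1 hxn n rfl] at h1
    linarith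
  · intro hn
    have hnn := h.unit n hn
    refine ⟨hnn, fun x hx => hx n hn, ?_⟩
    have heq : linSpan (cut N ∩ plane ⟨n, hnn⟩) = perp {n} :=
      le_antisymm (linSpan_le_perp.2 fun x hx => hx.2) (h.perp_le_linSpan hn)
    rw [spanRank_eq, heq, finrank_perp_singleton (ne_zero_of_unit hnn)]

theorem IsPolyhedron.isReduced {F : Set Space} (hF : IsPolyhedron F) :
    IsReduced (faceNormals F) ∧ cut (faceNormals F) = F := by
  obtain ⟨N, hN, rfl⟩ := exists_isReduced hF
  rw [hN.faceNormals_cut]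
  exact ⟨hN, rfl⟩

theorem reflection_image_cut (n : Normal) (N : Set V) :
    reflection n '' cut N = cut (refl n '' N) := by
  have hcoe : ∀ x : Space, (reflection n x : V) = refl n x := fun _ => rfl
  have hinv : ∀ x : Space, reflection n (reflection n x) = x := fun x => by
    apply Subtype.ext
    rw [hcoe, hcoe, refl_refl n.2]
  have hmem : ∀ x : Space, x ∈ cut (refl n '' N) ↔ reflection n x ∈ cut N := fun x => by
    simp only [cut, Set.mem_ofPred_eq, Set.forall_mem_image, mink_refl_left, hcoe]
  ext x
  rw [hmem]
  constructor
  · rintro ⟨y, hy, rfl⟩; rwa [hinv]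
  · exact fun hx => ⟨_, hx, hinv x⟩

/-- Outside `[-1, 1]` the function `Real.arccos` takes the constant values `0` and `π`. Neither
equals `π / k` with `k ≥ 2`, so here the angle determines the product of the normals. -/
theorem cos_eq_of_arccos_eq {x : ℝ} {k : ℕ} (hk : 2 ≤ k) (h : Real.arccos x = Real.pi / k) :
    x = Real.cos (Real.pi / k) := by
  have hk' : (2 : ℝ) ≤ k := by exact_mod_cast hk
  have hk0 : (0 : ℝ) < k := by linarith
  have hpos : 0 < Real.pi / k := div_pos Real.pi_pos hk0
  have hlt : Real.pi / k < Real.pi := by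
    rw [div_lt_iff₀ hk0]; nlinarith [Real.pi_pos]
  rw [← h, Real.cos_arccos]
  · by_contra hcon
    push Not at hcon
    rw [Real.arccos_of_le_neg_one hcon.le] at h
    exact hlt.ne' h
  · by_contra hcon
    push Not at hcon
    rw [Real.arccos_of_one_le hcon.le] at h
    exact hpos.ne h

/-- The Coxeter condition in terms of the normals. -/
theorem IsCoxeterPolyhedron.mink_eq {F : Set Space} (hF : IsCoxeterPolyhedron F) {n m : V}
    (hn : n ∈ faceNormals F) (hm : m ∈ faceNormals F) (hnm : n ≠ m) {x : V} (hx : x ∈ future)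
    (hnx : mink n x = 0) (hmx : mink m x = 0)
    (hother : ∀ l ∈ faceNormals F, l ≠ n → l ≠ m → mink l x < 0) :
    ∃ k : ℕ, 2 ≤ k ∧ mink n m = -Real.cos (Real.pi / k) := by
  obtain ⟨hred, hcut⟩ := hF.1.isReduced
  have hxN : x ∈ tileCone (faceNormals F) := ⟨hx, fun l hl => by
    by_cases h1 : l = n
    · rw [h1, hnx]
    by_cases h2 : l = m
    · rw [h2, hmx]
    exact (hother l hl h1 h2).le⟩
  obtain ⟨hn1, hn2⟩ := id hn
  obtain ⟨hm1, hm2⟩ := id hm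
  have hne : m ≠ -n := by
    rintro rfl
    obtain ⟨c, -, hc⟩ := hred.inner
    have h1 := hc n hn
    have h2 := hc _ hm
    rw [mink_neg_left] at h2
    linarith
  have hli : LinearIndependent ℝ ![n, m] := by
    rw [LinearIndependent.pair_iff' (ne_zero_of_unit hn1)]
    intro a ha
    rcases eq_or_eq_neg_of_smul hn1 hm1 ha.symm with e | e
    · exact hnm e.symm
    · exact hne e
  have hrank : spanRank (F ∩ plane ⟨n, hn1⟩ ∩ plane ⟨m, hm1⟩) = 2 := by
    have heq : linSpan (F ∩ plane ⟨n, hn1⟩ ∩ plane ⟨m, hm1⟩) = perp {n, m} := by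
      refine le_antisymm (linSpan_le.2 fun y hy => mem_perp.2 ?_) ?_
      · rintro _ (rfl | rfl)
        exacts [hy.1.2, hy.2]
      · refine le_linSpan hred.finite hxN (mem_perp.2 ?_) (fun l hl hlx v hv => ?_) fun y hy hyD => ?_
        · rintro _ (rfl | rfl) <;> assumption
        · by_cases h1 : l = n
          · rw [h1]; exact mem_perp.1 hv n (by simp)
          by_cases h2 : l = m
          · rw [h2]; exact mem_perp.1 hv m (by simp)
          exact absurd hlx (hother l hl h1 h2).ne
        · rw [hcut] at hy
          exact ⟨⟨hy, mem_perp.1 hyD n (by simp)⟩, mem_perp.1 hyD m (by simp)⟩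
    have h2 : Module.finrank ℝ (Submodule.span ℝ {n, m}) = 2 := by
      have := finrank_span_eq_card hli
      rwa [Matrix.range_cons, Matrix.range_cons, Matrix.range_empty, Set.union_empty,
        Set.singleton_union] at this
    rw [spanRank_eq, heq, finrank_perp, h2]
  obtain ⟨k, hk, hang⟩ := hF.2 _ _ hn2 hm2 hrank
  refine ⟨k, hk, ?_⟩
  have := cos_eq_of_arccos_eq hk hang
  simp only at this
  linarith

/-! ### Pyramids -/

theorem convex_future : Convex ℝ future := by
  have := convex_tileCone ∅
  have e : tileCone ∅ = future := by ext; simp [tileCone]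
  rwa [e] at this

/-- The closed cone over the convex hull of a set. -/
def posHull (A : Set V) : Set V := {v | ∃ c : ℝ, 0 ≤ c ∧ ∃ y ∈ convexHull ℝ A, v = c • y}

theorem posHull_add {A : Set V} {x y : V} (hx : x ∈ posHull A) (hy : y ∈ posHull A) :
    x + y ∈ posHull A := by
  obtain ⟨c, hc, x, hx, rfl⟩ := hx
  obtain ⟨d, hd, y, hy, rfl⟩ := hy
  obtain ⟨z, hz, e⟩ := (convex_convexHull ℝ A).exists_mem_add_smul_eq hx hy hc hd
  exact ⟨c + d, add_nonneg hc hd, z, hz, e.symm⟩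

theorem posHull_smul {A : Set V} {x : V} (hx : x ∈ posHull A) {c : ℝ} (hc : 0 ≤ c) :
    c • x ∈ posHull A := by
  obtain ⟨d, hd, x, hx, rfl⟩ := hx
  exact ⟨c * d, mul_nonneg hc hd, x, hx, smul_smul c d x⟩

theorem subset_posHull {A : Set V} {x : V} (hx : x ∈ convexHull ℝ A) : x ∈ posHull A :=
  ⟨1, zero_le_one, x, hx, (one_smul ℝ x).symm⟩

theorem posHull_mono {A B : Set V} (h : A ⊆ B) : posHull A ⊆ posHull B := by
  rintro _ ⟨c, hc, y, hy, rfl⟩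
  exact ⟨c, hc, y, convexHull_mono h hy, rfl⟩

theorem mem_posHull_insert {O v : V} {A : Set V} (hA : A.Nonempty) :
    v ∈ posHull (insert O A) ↔ ∃ s : ℝ, 0 ≤ s ∧ ∃ a ∈ posHull A, v = s • O + a := by
  constructor
  · rintro ⟨c, hc, y, hy, rfl⟩
    rw [convexHull_insert hA, convexJoin_singleton_left] at hy
    simp only [Set.mem_iUnion] at hy
    obtain ⟨a, ha, t, u, ht, hu, -, rfl⟩ := hy
    exact ⟨c * t, mul_nonneg hc ht, (c * u) • a, ⟨_, mul_nonneg hc hu, a, ha, rfl⟩, by module⟩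
  · rintro ⟨s, hs, a, ha, rfl⟩
    exact posHull_add (posHull_smul (subset_posHull (subset_convexHull ℝ _ (Set.mem_insert _ _))) hs)
      (posHull_mono (Set.subset_insert _ _) ha)

theorem posHull_future {A : Set V} (hA : A ⊆ future) {v : V} (hv : v ∈ posHull A) (h0 : v ≠ 0) :
    v ∈ future := by
  obtain ⟨c, hc, y, hy, rfl⟩ := hv
  refine future_smul (lt_of_le_of_ne hc ?_) (convexHull_min hA convex_future hy)
  rintro rfl
  exact h0 (zero_smul ℝ y)

theorem smul_coe_mem_posHull {A : Set Space} {x : Space} {c : ℝ} (hc : 0 < c) :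
    c • (x : V) ∈ posHull ((fun x : Space => (x : V)) '' A) ↔ x ∈ hull A := by
  constructor
  · rintro ⟨d, hd, y, hy, e⟩
    have hd' : 0 < d := lt_of_le_of_ne hd fun e' => by
      rw [← e', zero_smul] at e
      exact ne_zero_of_future (future_smul hc (coe_mem_future x)) e
    refine ⟨d⁻¹ * c, mul_pos (inv_pos.2 hd') hc, ?_⟩
    rwa [mul_smul, e, smul_smul, inv_mul_cancel₀ hd'.ne', one_smul]
  · rintro ⟨d, hd, hx⟩
    have : c • (x : V) = (c * d⁻¹) • d • (x : V) := by
      rw [smul_smul, mul_assoc, inv_mul_cancel₀ hd.ne', mul_one]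
    rw [this]
    exact ⟨_, (mul_pos hc (inv_pos.2 hd)).le, _, hx, rfl⟩

theorem image_coe_subset_future (A : Set Space) : (fun x : Space => (x : V)) '' A ⊆ future := by
  rintro _ ⟨x, -, rfl⟩; exact coe_mem_future x

/-! ### Coxeter decompositions as systems of tiles -/

section Decomposition

variable {P : Set Space} {T : Set (Set Space)} {K : Set V}

theorem IsCoxeterDecomposition.cover_cone (hT : IsCoxeterDecomposition P T)
    (hKP : ∀ (x : Space) (c : ℝ), 0 < c → (c • (x : V) ∈ K ↔ x ∈ P)) {v : V} (hv : v ∈ future) :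
    v ∈ K ↔ ∃ F ∈ T, v ∈ tileCone (faceNormals F) := by
  obtain ⟨c, hc, x, rfl⟩ := exists_pos_smul_coe hv
  rw [hKP x c hc, ← hT.cover, Set.mem_sUnion]
  refine exists_congr fun F => and_congr_right fun hF => ?_
  rw [smul_coe_mem_tileCone hc, (hT.coxeter F hF).1.isReduced.2]

theorem IsCoxeterDecomposition.eq_of_interior (hT : IsCoxeterDecomposition P T) {F G : Set Space}
    (hF : F ∈ T) (hG : G ∈ T) {x : V} (hx : x ∈ future) (hxF : ∀ n ∈ faceNormals F, mink n x < 0)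
    (hxG : ∀ n ∈ faceNormals G, mink n x < 0) : F = G := by
  by_contra hne
  obtain ⟨c, hc, y, rfl⟩ := exists_pos_smul_coe hx
  have hint : ∀ H ∈ T, (∀ n ∈ faceNormals H, mink n (c • (y : V)) < 0) → y ∈ interior H := by
    intro H hH h
    obtain ⟨h1, h2⟩ := (hT.coxeter H hH).1.isReduced
    have := mem_interior_cut h1.finite fun n hn => (mink_smul_neg_iff hc).1 (h n hn)
    rwa [h2] at this
  exact Set.disjoint_left.1 (hT.disjoint F hF G hG hne) (hint F hF hxF) (hint G hG hxG)

/-- The common part of two different tiles is not three-dimensional. -/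
theorem IsCoxeterDecomposition.linSpan_inter_ne_top (hT : IsCoxeterDecomposition P T)
    {F G : Set Space} (hF : F ∈ T) (hG : G ∈ T) (hne : F ≠ G) : linSpan (F ∩ G) ≠ ⊤ := by
  intro htop
  obtain ⟨hFr, hFc⟩ := (hT.coxeter F hF).1.isReduced
  obtain ⟨hGr, hGc⟩ := (hT.coxeter G hG).1.isReduced
  let N := faceNormals F ∪ faceNormals G
  have hN : N.Finite := hFr.finite.union hGr.finite
  have hunit : ∀ n ∈ N, mink n n = 1 := fun n hn => hn.elim (hFr.unit n) (hGr.unit n)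
  have hmem : ∀ x ∈ F ∩ G, (x : V) ∈ tileCone N := by
    rintro x ⟨hxF, hxG⟩
    rw [← hFc] at hxF
    rw [← hGc] at hxG
    exact ⟨coe_mem_future x, fun n hn => hn.elim (hxF n) (hxG n)⟩
  have hnonempty : (F ∩ G).Nonempty := by
    rw [Set.nonempty_iff_ne_empty]
    intro e
    rw [e, linSpan, Set.image_empty, Submodule.span_empty] at htop
    exact bot_ne_top htop
  obtain ⟨x₀, hx₀⟩ := hnonempty
  -- A common part spanning the whole space has a point on no face plane, which is interior to both
  -- tiles.
  obtain ⟨x, hx, hxN⟩ := exists_mem_forall_notMem_submodule (convex_tileCone N) hN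
    (fun m => perp {m}) ⟨x₀, hmem x₀ hx₀⟩ (fun m hm => by
      by_contra hcon
      push Not at hcon
      have h1 : linSpan (F ∩ G) ≤ perp {m} := linSpan_le.2 fun x hx => hcon x (hmem x hx)
      rw [htop] at h1
      have h2 := mem_perp.1 (h1 (x := m) trivial) m rfl
      rw [hunit m hm] at h2
      exact one_ne_zero h2)
  have hlt : ∀ m ∈ N, mink m x < 0 := fun m hm => lt_of_le_of_ne (hx.2 m hm) fun e =>
    hxN m hm (mem_perp.2 (by rintro _ rfl; exact e))
  exact hne (hT.eq_of_interior hF hG hx.1 (fun n hn => hlt n (Or.inl hn))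
    fun n hn => hlt n (Or.inr hn))

/-- Close to `x` there is an inner point `y` of the face, still interior to the body. Around `y` the
face is covered by its intersections with tiles just beyond it. By convexity one tile `G` spans the
whole plane there, so `F ∩ G` is two-dimensional; the face-to-face condition and the symmetry then
identify `G` with the mirror image. -/
theorem IsCoxeterDecomposition.reflection_mem (hT : IsCoxeterDecomposition P T)
    (hKP : ∀ (x : Space) (c : ℝ), 0 < c → (c • (x : V) ∈ K ↔ x ∈ P)) {F : Set Space} (hF : F ∈ T)
    {n : Normal} (hn : (n : V) ∈ faceNormals F) {x : V} (hx : x ∈ tileCone (faceNormals F))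
    (hnx : mink n x = 0) (hKx : K ∈ 𝓝 x) : reflection n '' F ∈ T := by
  obtain ⟨hFr, hFc⟩ := (hT.coxeter F hF).1.isReduced
  obtain ⟨f, hf, hnf, hfN⟩ := hFr.facet n hn
  have hev : ∀ᶠ ε : ℝ in 𝓝[>] 0, K ∈ 𝓝 (x + ε • f) :=
    (tendsto_line x f).eventually (eventually_mem_nhds_iff.2 hKx)
  obtain ⟨ε, ⟨hK', hf'⟩, hε⟩ := ((hev.and (eventually_future hx.1 f)).and eventually_pos_right).exists
  set y := x + ε • f with hy
  have hny : mink n y = 0 := by simp [hy, hnx, hnf]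
  have hyN : ∀ l ∈ faceNormals F \ {(n : V)}, mink l y < 0 := fun l hl => by
    rw [hy, mink_add_right, mink_smul_right]
    have h1 := hx.2 l hl.1
    have h2 := mul_neg_of_pos_of_neg hε (hfN l hl.1 hl.2)
    linarith
  have hU : {z | K ∈ 𝓝 z} ∩ {v | v ∈ future ∧ ∀ l ∈ faceNormals F \ {(n : V)}, mink l v < 0}
      ∈ 𝓝 y := inter_mem (eventually_mem_nhds_iff.2 hK')
    ((isOpen_interior_tileCone hFr.finite.sdiff).mem_nhds ⟨hf', hyN⟩)
  obtain ⟨r, hr, hrU⟩ := Metric.mem_nhds_iff.1 hU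
  let C : Set V := Metric.ball y r ∩ (perp {(n : V)} : Set V)
  have hC : Convex ℝ C := (convex_ball y r).inter (perp {(n : V)}).convex
  have hyC : y ∈ C := ⟨Metric.mem_ball_self hr, mem_perp.2 (by rintro _ rfl; exact hny)⟩
  have hcov : C ⊆ ⋃ G ∈ hT.finite.toFinset.filter (· ≠ F), (linSpan (F ∩ G) : Set V) := by
    intro z hz
    obtain ⟨hzK, hzf, hzN⟩ := hrU hz.1
    have hnz : mink n z = 0 := mem_perp.1 hz.2 _ rfl
    obtain ⟨M, hM, hzM, hfr⟩ := exists_tile_along (K := K) (𝒯 := faceNormals '' T)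
      (hT.finite.image _) (fun v hv hvK => by
        obtain ⟨G, hG, h⟩ := (hT.cover_cone hKP hv).1 hvK
        exact ⟨_, ⟨G, hG, rfl⟩, h⟩) (d := (n : V)) hzf (tendsto_line z n hzK)
    obtain ⟨G, hG, rfl⟩ := hM
    simp only [Set.mem_iUnion, Finset.mem_filter, Set.Finite.mem_toFinset]
    refine ⟨G, ⟨hG, ?_⟩, ?_⟩
    · rintro rfl
      obtain ⟨δ, hδ, hδ0⟩ := (hfr.and_eventually eventually_pos_right).exists
      have := hδ.2 n hn
      rw [mink_add_right, mink_smul_right, n.2, hnz] at this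
      linarith
    · have hzF : z ∈ tileCone (faceNormals F) := ⟨hzf, fun l hl => by
        by_cases e : l = n
        · rw [e, hnz]
        · exact (hzN l ⟨hl, e⟩).le⟩
      obtain ⟨c, hc, w, rfl⟩ := exists_pos_smul_coe hzf
      rw [smul_coe_mem_tileCone hc, hFc] at hzF
      rw [smul_coe_mem_tileCone hc, (hT.coxeter G hG).1.isReduced.2] at hzM
      exact (linSpan (F ∩ G)).smul_mem c (coe_mem_linSpan ⟨hzF, hzM⟩)
  obtain ⟨G, hG, hCG⟩ := exists_subset_submodule_of_convex hC _ (fun G => linSpan (F ∩ G))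
    ⟨y, hyC⟩ hcov
  simp only [Finset.mem_filter, Set.Finite.mem_toFinset] at hG
  obtain ⟨hG, hGF⟩ := hG
  have hle : perp {(n : V)} ≤ linSpan (F ∩ G) := by
    intro v hv
    have hev : ∀ᶠ ε : ℝ in 𝓝[>] 0, y + ε • v ∈ Metric.ball y r :=
      tendsto_line y v (Metric.ball_mem_nhds y hr)
    obtain ⟨δ, hδ, hδ0⟩ := (hev.and eventually_pos_right).exists
    have h1 := hCG ⟨hδ, (perp {(n : V)}).add_mem hyC.2 ((perp {(n : V)}).smul_mem δ hv)⟩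
    exact ((linSpan (F ∩ G)).smul_mem_iff hδ0.ne').1
      (((linSpan (F ∩ G)).add_mem_iff_right (hCG hyC)).1 h1)
  -- The rank is at least `3` since `F ∩ G` spans the plane of `n`, and less than `4` since the
  -- tiles are different.
  have hrank : spanRank (F ∩ G) = 3 := by
    have h1 := Submodule.finrank_mono hle
    rw [finrank_perp_singleton (ne_zero_of_unit n.2)] at h1
    have h2 := Submodule.finrank_lt (hT.linSpan_inter_ne_top hF hG hGF.symm)
    simp only [Module.finrank_fintype_fun_eq_card, Fintype.card_fin] at h2
    rw [spanRank_eq]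
    omega
  obtain ⟨⟨n', hn', hFn'⟩, hGface⟩ := hT.faceToFace F hF G hG hGF.symm hrank
  have hFn : F ∩ G = F ∩ plane n := by
    rw [hFn']
    have h1 : perp {(n : V)} ≤ perp {(n' : V)} := by
      refine hle.trans (linSpan_le_perp.2 fun x hx => ?_)
      rw [hFn'] at hx
      exact hx.2
    congr 1
    ext x
    change mink n' x = 0 ↔ mink n x = 0
    rcases perp_le_perp n.2 n'.2 h1 with e | e <;> rw [e]
    rw [mink_neg_left, neg_eq_zero]
  rw [hFn] at hGface
  obtain ⟨_, hn2⟩ := hn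
  rw [← hT.symmetric F hF G hG hGF.symm n hn2 hGface]
  exact hG

theorem IsCoxeterDecomposition.isTileSystem (hT : IsCoxeterDecomposition P T)
    (hKP : ∀ (x : Space) (c : ℝ), 0 < c → (c • (x : V) ∈ K ↔ x ∈ P))
    (hadd : ∀ x ∈ K, ∀ y ∈ K, x + y ∈ K) : IsTileSystem K (faceNormals '' T) where
  finite := hT.finite.image _
  finite_normals := by
    rintro _ ⟨F, hF, rfl⟩; exact (hT.coxeter F hF).1.isReduced.1.finite
  unit := by
    rintro _ ⟨F, hF, rfl⟩; exact (hT.coxeter F hF).1.isReduced.1.unit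
  inner := by
    rintro _ ⟨F, hF, rfl⟩; exact (hT.coxeter F hF).1.isReduced.1.inner
  facet := by
    rintro _ ⟨F, hF, rfl⟩; exact (hT.coxeter F hF).1.isReduced.1.facet
  angle := by
    rintro _ ⟨F, hF, rfl⟩ n hn m hm hnm x hx hnx hmx hother
    exact (hT.coxeter F hF).mink_eq hn hm hnm hx hnx hmx hother
  disjoint := by
    rintro _ ⟨F, hF, rfl⟩ _ ⟨G, hG, rfl⟩ x hx hxF hxG
    rw [hT.eq_of_interior hF hG hx hxF hxG]
  cover := fun v hv => by
    rw [hT.cover_cone hKP hv]; simp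
  add_mem := hadd
  neighbor := by
    rintro _ ⟨F, hF, rfl⟩ n hn x hx hnx hKx
    obtain ⟨hFr, hFc⟩ := (hT.coxeter F hF).1.isReduced
    have hnn := hFr.unit n hn
    refine ⟨_, hT.reflection_mem hKP hF (n := ⟨n, hnn⟩) hn hx hnx hKx, ?_⟩
    rw [← (hFr.refl hnn).faceNormals_cut, ← reflection_image_cut ⟨n, hnn⟩, hFc]

end Decomposition

theorem mem_hull_range {v : Fin 4 → Space} {x : Space} :
    x ∈ hull (Set.range v) ↔ ∃ c : Fin 4 → ℝ, (∀ i, 0 ≤ c i) ∧ (x : V) = ∑ i, c i • (v i : V) := by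
  have hrange : (fun x : Space => (x : V)) '' Set.range v = Set.range fun i => (v i : V) := by
    rw [← Set.range_comp]; rfl
  have hx := smul_coe_mem_posHull (A := Set.range v) (x := x) one_pos
  rw [one_smul, hrange] at hx
  rw [← hx]
  constructor
  · rintro ⟨c, hc, y, hy, e⟩
    have hconv : Convex ℝ {y : V | ∃ g : Fin 4 → ℝ, (∀ i, 0 ≤ g i) ∧ y = ∑ i, g i • (v i : V)} := by
      rintro _ ⟨g, hg, rfl⟩ _ ⟨g', hg', rfl⟩ a b ha hb -
      refine ⟨fun i => a * g i + b * g' i, fun i => add_nonneg (mul_nonneg ha (hg i))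
        (mul_nonneg hb (hg' i)), ?_⟩
      simp only [Finset.smul_sum, add_smul, mul_smul, Finset.sum_add_distrib]
    obtain ⟨g, hg, rfl⟩ := convexHull_min (by
      rintro _ ⟨i, rfl⟩
      refine ⟨Pi.single i 1, fun j => ?_, ?_⟩
      · by_cases hij : j = i
        · subst hij; simp
        · simp [hij]
      · rw [Finset.sum_eq_single i] <;> simp +contextual) hconv hy
    exact ⟨fun i => c * g i, fun i => mul_nonneg hc (hg i), by
      rw [e]; simp only [Finset.smul_sum, mul_smul]⟩
  · rintro ⟨c, hc, e⟩
    rw [e]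
    have h0 : (0 : V) ∈ posHull (Set.range fun i => (v i : V)) :=
      ⟨0, le_rfl, v 0, subset_convexHull ℝ _ ⟨0, rfl⟩, (zero_smul ℝ _).symm⟩
    refine Finset.sum_induction _ (· ∈ posHull (Set.range fun i => (v i : V)))
      (fun _ _ => posHull_add) h0 fun i _ => ?_
    exact posHull_smul (subset_posHull (subset_convexHull ℝ _ (Set.mem_range_self i))) (hc i)

theorem IsSimplexTile.isTetrahedron {F : Set Space} (hF : IsPolyhedron F)
    (h : IsSimplexTile (faceNormals F)) : IsTetrahedron F := by
  obtain ⟨v, hv, hvf, hmem⟩ := h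
  choose c hc y hy using fun i => exists_pos_smul_coe (hvf i)
  refine ⟨y, ?_, ?_⟩
  · have := hv.units_smul fun i => Units.mk0 (c i)⁻¹ (inv_pos.2 (hc i)).ne'
    convert this using 1
    ext1 i
    rw [Pi.smul_apply', hy i, Units.smul_mk0, smul_smul, inv_mul_cancel₀ (hc i).ne', one_smul]
  · ext x
    rw [mem_hull_range]
    have h1 : x ∈ F ↔ (x : V) ∈ tileCone (faceNormals F) := by
      rw [coe_mem_tileCone, hF.isReduced.2]
    rw [h1, hmem _ (coe_mem_future x)]
    constructor
    · rintro ⟨g, hg, e⟩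
      refine ⟨fun i => g i * c i, fun i => mul_nonneg (hg i) (hc i).le, ?_⟩
      rw [e]
      exact Finset.sum_congr rfl fun i _ => by rw [mul_smul, ← hy i]
    · rintro ⟨g, hg, e⟩
      refine ⟨fun i => g i * (c i)⁻¹, fun i => mul_nonneg (hg i) (inv_pos.2 (hc i)).le, ?_⟩
      rw [e]
      exact Finset.sum_congr rfl fun i _ => by
        rw [hy i, smul_smul, mul_assoc, inv_mul_cancel₀ (hc i).ne', mul_one]

/-- The base of a pyramid is covered by faces of tiles. -/
theorem IsCoxeterDecomposition.exists_face_in_base {P : Set Space} {T : Set (Set Space)}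
    (hT : IsCoxeterDecomposition P T) {A : Set Space} {b : Normal} (hAb : A ⊆ plane b)
    (hA : spanRank A = 3) (hAP : hull A ⊆ P) (hPb : P ⊆ halfSpace b) :
    ∃ F ∈ T, (b : V) ∈ faceNormals F := by
  have hne : A.Nonempty := by
    rw [Set.nonempty_iff_ne_empty]
    intro e
    rw [spanRank_eq, e, linSpan, Set.image_empty, Submodule.span_empty, finrank_bot] at hA
    omega
  -- The base is convex and covered by the spans of finitely many sets `F ∩ plane b`, so it lies in
  -- one of them, which must then be the whole plane.
  obtain ⟨F, hF, hsub⟩ := exists_subset_submodule_of_convex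
    (convex_convexHull ℝ ((fun x : Space => (x : V)) '' A)) hT.finite.toFinset
    (fun F => linSpan (F ∩ plane b)) (hne.image _).convexHull (by
      intro z hz
      have hzf : z ∈ future := convexHull_min (image_coe_subset_future A) convex_future hz
      have hzb : z ∈ perp {(b : V)} := convexHull_min (by
        rintro _ ⟨x, hx, rfl⟩
        exact mem_perp.2 (by rintro _ rfl; exact hAb hx)) (perp {(b : V)}).convex hz
      obtain ⟨c, hc, y, rfl⟩ := exists_pos_smul_coe hzf
      have hyP : y ∈ P := hAP ⟨c, hc, hz⟩
      rw [← hT.cover, Set.mem_sUnion] at hyP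
      obtain ⟨F, hF, hyF⟩ := hyP
      simp only [Set.mem_iUnion, Set.Finite.mem_toFinset]
      refine ⟨F, hF, (linSpan _).smul_mem c (coe_mem_linSpan ⟨hyF, ?_⟩)⟩
      exact mem_perp.1 (((perp {(b : V)}).smul_mem_iff hc.ne').1 hzb) _ rfl)
  rw [Set.Finite.mem_toFinset] at hF
  refine ⟨F, hF, b.2, fun x hx => hPb (hT.cover ▸ Set.mem_sUnion_of_mem hx hF), ?_⟩
  have h1 : linSpan A ≤ linSpan (F ∩ plane b) :=
    linSpan_le.2 fun x hx => hsub (subset_convexHull ℝ _ (Set.mem_image_of_mem _ hx))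
  have h2 : linSpan (F ∩ plane b) ≤ perp {(b : V)} := linSpan_le_perp.2 fun x hx => hx.2
  have h3 := Submodule.finrank_mono h1
  have h4 := Submodule.finrank_mono h2
  rw [finrank_perp_singleton (ne_zero_of_unit b.2)] at h4
  rw [spanRank_eq] at hA ⊢
  have : (⟨(b : V), b.2⟩ : Normal) = b := rfl
  rw [this]
  omega

theorem plane_neg (b : Normal) (hb : mink (-(b : V)) (-(b : V)) = 1) :
    plane ⟨-(b : V), hb⟩ = plane b := by
  ext x
  change mink (-(b : V)) x = 0 ↔ mink b x = 0
  rw [mink_neg_left, neg_eq_zero]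

end Hyp3

/-! ### The theorem -/

theorem lemmal3p1 (P : Set Hyp3.Space) (T : Set (Set Hyp3.Space))
    (hP : Hyp3.IsBoundedPyramid P) (hT : Hyp3.IsCoxeterDecomposition P T) :
    ∀ F ∈ T, Hyp3.IsTetrahedron F := by
  open Hyp3 in
  obtain ⟨O, A, b, -, hAb, hA, hOb, hPA⟩ := hP
  -- The normal of the base is oriented so that the apex lies on its inner side.
  obtain ⟨b, hAb, hbO⟩ : ∃ b : Normal, A ⊆ plane b ∧ mink b O < 0 := by
    rcases lt_or_gt_of_ne (show mink b O ≠ 0 from hOb) with h | h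
    · exact ⟨b, hAb, h⟩
    · have hb : mink (-(b : V)) (-(b : V)) = 1 := by simpa using b.2
      refine ⟨⟨-(b : V), hb⟩, by rwa [plane_neg], by simpa using h⟩
  set A' : Set V := (fun x : Space => (x : V)) '' A with hA'
  set K : Set V := posHull (insert (O : V) A') with hKdef
  have hK : K = posHull ((fun x : Space => (x : V)) '' insert O A) := by
    rw [Set.image_insert_eq]
  have hKf : ∀ x ∈ K, x ≠ 0 → x ∈ future := fun x hx h0 => by
    rw [hK] at hx
    exact posHull_future (image_coe_subset_future _) hx h0
  have hne : A'.Nonempty := by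
    refine Set.Nonempty.image _ (Set.nonempty_iff_ne_empty.2 fun e => ?_)
    rw [spanRank_eq, e, linSpan, Set.image_empty, Submodule.span_empty, finrank_bot] at hA
    omega
  have hKP : ∀ (x : Space) (c : ℝ), 0 < c → (c • (x : V) ∈ K ↔ x ∈ P) := fun x c hc => by
    rw [hK, smul_coe_mem_posHull hc, hPA]
  have hsys := hT.isTileSystem hKP fun x hx y hy => posHull_add hx hy
  have hAb' : ∀ a ∈ posHull A', mink b a = 0 := by
    rintro _ ⟨c, -, a, ha, rfl⟩
    have : a ∈ perp {(b : V)} := convexHull_min (by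
      rintro _ ⟨x, hx, rfl⟩
      exact mem_perp.2 (by rintro _ rfl; exact hAb hx)) (perp {(b : V)}).convex ha
    rw [mink_smul_right, mem_perp.1 this _ rfl, mul_zero]
  have hPb : P ⊆ halfSpace b := fun x hx => by
    have := (hKP x 1 one_pos).2 hx
    rw [one_smul, hKdef, mem_posHull_insert hne] at this
    obtain ⟨s, hs, a, ha, e⟩ := this
    change mink b x ≤ 0
    rw [e, mink_add_right, mink_smul_right, hAb' a ha, add_zero]
    exact mul_nonpos_of_nonneg_of_nonpos hs hbO.le
  obtain ⟨F₀, hF₀, hbF₀⟩ := hT.exists_face_in_base hAb hA (by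
    rw [hPA]
    rintro x ⟨c, hc, hx⟩
    exact ⟨c, hc, convexHull_mono (Set.image_mono (Set.subset_insert _ _)) hx⟩) hPb
  obtain ⟨N, hN, hNs⟩ := hsys.exists_isSimplexTile hKf (hsys.exists_simplex_of_apex
    (O := O) (b := b) (B := posHull A') (coe_mem_future O) (mem_walls ⟨F₀, hF₀, rfl⟩ hbF₀) hbO
    (fun v => mem_posHull_insert hne) hAb'
    (by
      obtain ⟨a, ha⟩ := hne
      exact ⟨0, le_rfl, a, subset_convexHull ℝ _ ha, (zero_smul ℝ a).symm⟩)
    (fun a ha c hc => posHull_smul ha hc)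
    -- Nonzero vectors of the cone over the base are future-directed, so two of them never cancel.
    (fun a ha a' ha' h0 => by
      by_contra hne
      have h1 := posHull_future (image_coe_subset_future A) ha hne
      have h2 : a' ≠ 0 := by rintro rfl; exact hne (by simpa using h0)
      exact ne_zero_of_future (future_add h1 (posHull_future (image_coe_subset_future A) ha' h2)) h0))
  intro F hF
  refine IsSimplexTile.isTetrahedron (hT.coxeter F hF).1 ?_
  exact hsys.forall_of_refl (fun N hN n hn _ hQ => hQ.refl (hsys.unit N hN n hn)) hN ⟨F, hF, rfl⟩ hNs
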